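/- **Setting.** Let $f:\mathbb R\to[0,+\infty]$ be convex and lower semicontinuous, with $f(0)<\infty$, and such that for some $\gamma>0$ one has $f(t)\ge\gamma\sqrt{1+t^2}$ for all $t\in\mathbb R$. Let $f^\infty(t)=\lim_{s\to+\infty}f(st)/s\in[0,+\infty]$ be its recession function. For $\theta\in\mathbb S^1=\mathbb R/2\pi\mathbb Z$ let $\underline\theta=(\cos\theta,\sin\theta)$, and for $p=(p^x,p^\theta)\in\mathbb R^2\times\mathbb R$ let $$h(\theta,p)=\begin{cases}|p^x|\,f(p^\theta/|p^x|)&\text{if }p^x\in\mathbb R_+\underline\theta,\ p^x\ne0,\\ f^\infty(p^\theta)&\text{if }p^x=0,\\ +\infty&\text{otherwise.}\end{cases}$$ For an open set $\Omega\subset\mathbb R^2$ and $u\in L^1(\Omega)$ let $$F(u)=\inf\Big\{\int_{\Omega\times\mathbb S^1}h\Big(\theta,\frac{\sigma}{|\sigma|}\Big)\,d|\sigma|\Big\}\in[0,+\infty],$$ where the infimum is over all bounded $\mathbb R^3$-valued Radon measures $\sigma=(\sigma^x,\sigma^\theta)$ on $\Omega\times\mathbb S^1$ (with total variation $|\sigma|$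 and density $\sigma/|\sigma|$) such that * $\operatorname{div}\sigma=0$, that is, $\int_{\Omega\times\mathbb S^1}\big(\nabla_x\psi\cdot d\sigma^x+\partial_\theta\psi\,d\sigma^\theta\big)=0$ for all $\psi\in C^1_c(\Omega\times\mathbb S^1)$; * $\int_{\mathbb S^1}\sigma^x=(Du)^\perp$, that is, $\int_{\Omega\times\mathbb S^1}\varphi^\perp\cdot d\sigma^x=-\int_\Omega u\,\operatorname{div}\varphi\,dx$ for all $\varphi\in C^1_c(\Omega;\mathbb R^2)$, where $(v_1,v_2)^\perp=(v_2,-v_1)$. The infimum of the empty set is $+\infty$. The space $C^\infty(\overline\Omega)$ consists of the restrictions to $\overline\Omega$ of functions in $C^\infty(\mathbb R^2)$. **Proposition.** Let $\Omega\subset\mathbb R^2$ be open, bounded and convex. Then for every $u\in L^1(\Omega)$ with $F(u)<\infty$ there is a sequence of functions $u_n\in C^\infty(\overline\Omega)$ such that $u_n\to u$ in $L^1(\Omega)$ and $\lim_{n\to\infty}F(u_n)=F(u)$. -/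

import Mathlib

open MeasureTheory Set Filter Topology
open scoped ENNReal NNReal ContDiff

noncomputable section

namespace RotoTranslation

/-- The Euclidean plane. -/
abbrev Plane : Type := EuclideanSpace ℝ (Fin 2)

/-- The circle of orientations, parametrised by the angle modulo `2π`. -/
abbrev S1 : Type := AddCircle (2 * Real.pi)

instance two_pi_pos_fact : Fact (0 < 2 * Real.pi) := ⟨Real.two_pi_pos⟩

/-- The unit vector `(cos θ, sin θ)` of the orientation `θ`. -/
def unitVec (θ : S1) : Plane :=
  !₂[((AddCircle.toCircle θ : Circle) : ℂ).re, ((AddCircle.toCircle θ : Circle) : ℂ).im]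

theorem unitVec_coe (t : ℝ) : unitVec (t : S1) = !₂[Real.cos t, Real.sin t] := by
  have h : 2 * Real.pi / (2 * Real.pi) = 1 := div_self Real.two_pi_pos.ne'
  simp only [unitVec, AddCircle.toCircle_apply_mk, h, one_mul, Circle.coe_exp,
    Complex.exp_ofReal_mul_I_re, Complex.exp_ofReal_mul_I_im]

/-- The rotation by a right angle `(v₁, v₂) ↦ (v₂, -v₁)`. -/
def perp (v : Plane) : Plane := !₂[v 1, -v 0]

/-- The divergence of a planar vector field. -/
def divergence (φ : Plane → Plane) (x : Plane) : ℝ :=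
  ∑ i : Fin 2, fderiv ℝ φ x (EuclideanSpace.single i 1) i

/-- The recession function `t ↦ lim_{s → +∞} f (s t) / s`. For `f` convex and finite at `0` the
limit exists in `[0, ∞]`, and the `limsup` is that limit. -/
def recession (f : ℝ → ℝ≥0∞) (t : ℝ) : ℝ≥0∞ :=
  limsup (fun s : ℝ => f (s * t) / ENNReal.ofReal s) atTop

open Classical in
/-- The one-homogeneous integrand `h(θ, p)`, `p = (px, pθ) ∈ ℝ² × ℝ`. -/
def lineIntegrand (f : ℝ → ℝ≥0∞) (θ : S1) (px : Plane) (pθ : ℝ) : ℝ≥0∞ :=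
  if px = 0 then recession f pθ
  else if ∃ c : ℝ, 0 ≤ c ∧ px = c • unitVec θ then ENNReal.ofReal ‖px‖ * f (pθ / ‖px‖)
  else ⊤

/-- A bounded Radon measure `σ` on `Ω × S1` with values in `ℝ² × ℝ = ℝ³`, given by its polar
decomposition `σ = (dirX, dirθ) · tv`: `tv = |σ|` is the total variation measure (a finite Borel
measure carried by `Ω × S1`) and `(dirX, dirθ) = σ / |σ|` is the density of `σ` with respect to
`|σ|`, which has Euclidean norm one `|σ|`-almost everywhere. -/
structure VectorRadonMeasure (Ω : Set Plane) where
  tv : Measure (Plane × S1)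
  finite_tv : IsFiniteMeasure tv
  tv_compl : tv (Ω ×ˢ (univ : Set S1))ᶜ = 0
  dirX : Plane × S1 → Plane
  dirθ : Plane × S1 → ℝ
  measurable_dirX : Measurable dirX
  measurable_dirθ : Measurable dirθ
  norm_dir : ∀ᵐ q ∂tv, ‖dirX q‖ ^ 2 + (dirθ q) ^ 2 = 1

/-- `ψ ∈ C¹_c(Ω × S1)`; the regularity is that of the lift `(x, t) ↦ ψ (x, t mod 2π)`. -/
def IsTestFunction (Ω : Set Plane) (ψ : Plane × S1 → ℝ) : Prop :=
  ContDiff ℝ 1 (fun q : Plane × ℝ => ψ (q.1, (q.2 : S1))) ∧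
    HasCompactSupport ψ ∧ tsupport ψ ⊆ Ω ×ˢ (univ : Set S1)

/-- `φ ∈ C¹_c(Ω; ℝ²)`. -/
def IsTestField (Ω : Set Plane) (φ : Plane → Plane) : Prop :=
  ContDiff ℝ 1 φ ∧ HasCompactSupport φ ∧ tsupport φ ⊆ Ω

namespace VectorRadonMeasure

variable {Ω : Set Plane}

/-- `div σ = 0` in `Ω × S1`: `∫ ∇ψ · dσ = 0` for all test functions, where
`∇ψ · (px, pθ) = ∇ₓψ · px + ∂_θψ pθ`. -/
def DivFree (σ : VectorRadonMeasure Ω) : Prop :=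
  ∀ ψ : Plane × S1 → ℝ, IsTestFunction Ω ψ →
    ∫ q, (fderiv ℝ (fun y : Plane => ψ (y, q.2)) q.1 (σ.dirX q) +
      deriv (fun t : ℝ => ψ (q.1, q.2 + (t : S1))) 0 * σ.dirθ q) ∂σ.tv = 0

/-- `∫_{S1} σˣ dθ = (Du)^⊥` in `Ω`: `∫ φ^⊥ · dσˣ = - ∫_Ω u div φ` for all test fields. -/
def HasMarginal (σ : VectorRadonMeasure Ω) (u : Plane → ℝ) : Prop :=
  ∀ φ : Plane → Plane, IsTestField Ω φ →
    ∫ q, inner ℝ (perp (φ q.1)) (σ.dirX q) ∂σ.tv = -∫ x in Ω, u x * divergence φ x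

/-- `∫_{Ω × S1} h(θ, σ) = ∫ h(θ, σ / |σ|) d|σ|`. -/
def energy (f : ℝ → ℝ≥0∞) (σ : VectorRadonMeasure Ω) : ℝ≥0∞ :=
  ∫⁻ q, lineIntegrand f q.2 (σ.dirX q) (σ.dirθ q) ∂σ.tv

end VectorRadonMeasure

/-- The functional `F(u)`: the infimum of the energies of the admissible fields for `u`
(`+∞` if there is none). -/
def totalRTVariation (f : ℝ → ℝ≥0∞) (Ω : Set Plane) (u : Plane → ℝ) : ℝ≥0∞ :=
  ⨅ (σ : VectorRadonMeasure Ω) (_ : σ.DivFree) (_ : σ.HasMarginal u), σ.energy f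

/-- `u ∈ C^∞(closure Ω)`: `u` is on `closure Ω` the restriction of a smooth function on the
plane. -/
def SmoothUpToBoundary (Ω : Set Plane) (u : Plane → ℝ) : Prop :=
  ∃ v : Plane → ℝ, ContDiff ℝ ∞ v ∧ EqOn u v (closure Ω)

end RotoTranslation

end

/-! The approximants dilate and mollify at once. Extend `u` by zero outside `Ω`, let `ρ` be a smooth
probability density supported in a ball inside `Ω`, and for `t > 1` put `w_t(x) = ∫ u(t⁻¹ x + (1 -
t⁻¹) y) ρ(y) dy`. Up to rescaling, `w_t` is a convolution of `u` with a smooth kernel, hence smooth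
on the whole plane, and `w_t → u` in `L¹` as `t → 1`.

Upper bound. Fix `σ` admissible for `u` and `y ∈ Ω`. Push `σ` forward by `(x, θ) ↦ (t x - (t - 1) y,
θ)`, multiplying its spatial component by `t`. Convexity makes the image of `Ω` contain `Ω`, so test
functions on `Ω` pull back to test functions on `Ω`, and the pushed measure is admissible for the
dilate of `u`. Orientations are unchanged, so the vectors stay in the cone where the integrand may
be finite. The energy grows by at most `(t - 1) f(0) |σ|`, see `lineIntegrand_smul_le`. Averaging
over `y` preserves the constraints and this bound, so `limsup F(w_t) ≤ F(u)`.

Lower bound. `totalRTVariation_le_liminf` gives `F(u) ≤ liminf F(w_t)`: the bound `f ≥ γ √(1 + t²)`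
controls masses, and weak compactness does the rest.

Both halves use measures on pairs (position, vector) instead of vector measures. There the
constraints and the energy are linear in the measure. `exists_barycenter` returns to vector measures
without raising the energy, by Jensen. Jensen, homogeneity, measurability and lower semicontinuity
all come from writing the integrand as a countable supremum of positive parts of linear forms,
`exists_seq_lineIntegrand_eq_iSup`. -/

namespace RotoTranslation

/-! ### The integrand as a supremum of linear forms -/

/-- The pairs `(a, b)` for which the positive part of `r ↦ a + b r` minorises `f`, together with
a free parameter. -/
def affineMinorants (f : ℝ → ℝ≥0∞) : Set (ℝ × ℝ × ℝ) :=
  {k | ∀ r : ℝ, ENNReal.ofReal (k.1 + k.2.1 * r) ≤ f r}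

/-- The linear form in `p = (px, pθ)` attached to `k = (a, b, e)` at the orientation `θ`. -/
noncomputable def minorantForm (k : ℝ × ℝ × ℝ) (θ : S1) : Plane × ℝ →L[ℝ] ℝ :=
  (innerSL ℝ (k.1 • unitVec θ + k.2.2 • perp (unitVec θ))).comp (ContinuousLinearMap.fst ℝ Plane ℝ)
    + k.2.1 • ContinuousLinearMap.snd ℝ Plane ℝ

theorem minorantForm_apply (k : ℝ × ℝ × ℝ) (θ : S1) (p : Plane × ℝ) :
    minorantForm k θ p = k.1 * inner ℝ (unitVec θ) p.1 + k.2.2 * inner ℝ (perp (unitVec θ)) p.1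
      + k.2.1 * p.2 := by
  simp [minorantForm]

theorem continuous_unitVec : Continuous unitVec := by
  unfold unitVec
  have h1 : Continuous fun θ : S1 => ((AddCircle.toCircle θ : Circle) : ℂ) :=
    continuous_subtype_val.comp AddCircle.continuous_toCircle
  refine (PiLp.continuous_toLp 2 _).comp (continuous_pi fun i => ?_)
  fin_cases i
  · exact Complex.continuous_re.comp h1
  · exact Complex.continuous_im.comp h1

theorem continuous_perp : Continuous perp := by
  unfold perp
  refine (PiLp.continuous_toLp 2 _).comp (continuous_pi fun i => ?_)
  fin_cases i <;> simp <;> fun_prop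

theorem norm_unitVec (θ : S1) : ‖unitVec θ‖ = 1 := by
  obtain ⟨t, rfl⟩ := QuotientAddGroup.mk_surjective θ
  have := unitVec_coe t
  change ‖unitVec (t : S1)‖ = 1
  rw [this, EuclideanSpace.norm_eq]
  simp

theorem norm_perp (v : Plane) : ‖perp v‖ = ‖v‖ := by
  rw [EuclideanSpace.norm_eq, EuclideanSpace.norm_eq]
  simp [perp, add_comm]

theorem inner_perp_self (v : Plane) : inner ℝ (perp v) v = 0 := by
  simp [perp, PiLp.inner_apply]; ring

/-- The decomposition of a vector along `unitVec θ` and its perpendicular. -/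
theorem eq_smul_unitVec_of_inner_perp_eq_zero (θ : S1) (v : Plane)
    (h : inner ℝ (perp (unitVec θ)) v = 0) : v = inner ℝ (unitVec θ) v • unitVec θ := by
  have hn : (unitVec θ 0) ^ 2 + (unitVec θ 1) ^ 2 = 1 := by
    have := norm_unitVec θ
    rw [EuclideanSpace.norm_eq, Real.sqrt_eq_one] at this
    simpa using this
  simp [perp, PiLp.inner_apply] at h
  ext i
  fin_cases i
  · simp [PiLp.inner_apply]
    linear_combination (-(v 0)) * hn + (unitVec θ 1) * h
  · simp [PiLp.inner_apply]
    linear_combination (-(v 1)) * hn - (unitVec θ 0) * h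

theorem continuous_minorantForm :
    Continuous fun z : (ℝ × ℝ × ℝ) × S1 × (Plane × ℝ) => minorantForm z.1 z.2.1 z.2.2 := by
  simp only [minorantForm_apply]
  have h1 : Continuous fun z : (ℝ × ℝ × ℝ) × S1 × (Plane × ℝ) => unitVec z.2.1 :=
    continuous_unitVec.comp (by fun_prop)
  have h2 : Continuous fun z : (ℝ × ℝ × ℝ) × S1 × (Plane × ℝ) => perp (unitVec z.2.1) :=
    continuous_perp.comp h1
  fun_prop

section Integrand

variable {f : ℝ → ℝ≥0∞}

/-- These forms detect the value `⊤`: very negative `a` penalises vectors opposite to `unitVec θ`,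
and the unconstrained `e` penalises transverse ones. -/
theorem zero_mem_affineMinorants (a e : ℝ) (ha : a ≤ 0) : (a, (0 : ℝ), e) ∈ affineMinorants f := by
  intro r
  simp [ENNReal.ofReal_of_nonpos ha]

theorem affineMinorants_fst_le (hf_zero : f 0 ≠ ⊤) {k : ℝ × ℝ × ℝ} (hk : k ∈ affineMinorants f) :
    k.1 ≤ (f 0).toReal := by
  have := hk 0
  simp only [mul_zero, add_zero] at this
  exact (ENNReal.ofReal_le_iff_le_toReal hf_zero).1 this

/-- A convex lower semicontinuous function is approached from below by (positive parts of) its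
affine minorants. -/
theorem exists_affineMinorant_gt (hf_convex : ConvexOn ℝ≥0 (univ : Set ℝ) f)
    (hf_lsc : LowerSemicontinuous f) (hf_zero : f 0 ≠ ⊤) {s y : ℝ}
    (hy : ENNReal.ofReal y < f s) :
    ∃ a b : ℝ, (∀ r, ENNReal.ofReal (a + b * r) ≤ f r) ∧ y < a + b * s := by
  -- The real epigraph. Without `0 ≤ p.2` the fibre over a zero of `f` would be all of `ℝ`, because
  -- `ENNReal.ofReal` truncates, and convexity could fail.
  let A : Set (ℝ × ℝ) := {p | 0 ≤ p.2 ∧ f p.1 ≤ ENNReal.ofReal p.2}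
  have hA_closed : IsClosed A := by
    have h1 := hf_lsc.isClosed_epigraph
    exact (isClosed_le continuous_const continuous_snd).inter
      (h1.preimage (f := fun p : ℝ × ℝ => (p.1, ENNReal.ofReal p.2))
        (continuous_fst.prodMk (ENNReal.continuous_ofReal.comp continuous_snd)))
  have hA_convex : Convex ℝ A := by
    intro p hp q hq a b ha hb hab
    lift a to ℝ≥0 using ha
    lift b to ℝ≥0 using hb
    have hc : f (a • p.1 + b • q.1) ≤ a • f p.1 + b • f q.1 :=
      hf_convex.2 (mem_univ p.1) (mem_univ q.1) zero_le zero_le (by exact_mod_cast hab)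
    have hp2 := hp.1
    have hq2 := hq.1
    change 0 ≤ a * p.2 + b * q.2 ∧ f (a • p.1 + b • q.1) ≤ ENNReal.ofReal (a * p.2 + b * q.2)
    refine ⟨by positivity, le_trans hc ?_⟩
    rw [ENNReal.ofReal_add (by positivity) (by positivity), ENNReal.ofReal_mul a.coe_nonneg,
      ENNReal.ofReal_mul b.coe_nonneg, ENNReal.ofReal_coe_nnreal, ENNReal.ofReal_coe_nnreal,
      ENNReal.smul_def, ENNReal.smul_def, smul_eq_mul, smul_eq_mul]
    exact add_le_add (mul_le_mul_right hp.2 _) (mul_le_mul_right hq.2 _)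
  have hnot : (s, y) ∉ A := fun h => not_le.2 hy h.2
  obtain ⟨L, c, hLs, hLA⟩ := geometric_hahn_banach_point_closed hA_convex hA_closed hnot
  set α := L (1, 0)
  set β := L (0, 1)
  have hL : ∀ r v, L (r, v) = α * r + β * v := by
    intro r v
    have : (r, v) = r • ((1 : ℝ), (0 : ℝ)) + v • ((0 : ℝ), (1 : ℝ)) := by simp
    rw [this, map_add, map_smul, map_smul]
    simp [α, β, mul_comm]
  have h0 : ∀ v, (f 0).toReal ≤ v → (0, v) ∈ A := fun v hv =>
    ⟨ENNReal.toReal_nonneg.trans hv,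
      (ENNReal.le_ofReal_iff_toReal_le hf_zero (ENNReal.toReal_nonneg.trans hv)).2 hv⟩
  -- The fibre of `A` over `0` is unbounded above, which excludes a negative coefficient.
  have hβ : 0 ≤ β := by
    by_contra hβ
    push Not at hβ
    have h1 := hLA (0, max (f 0).toReal (c / β)) (h0 _ (le_max_left _ _))
    rw [hL] at h1
    have h2 : β * max (f 0).toReal (c / β) ≤ β * (c / β) :=
      mul_le_mul_of_nonpos_left (le_max_right _ _) hβ.le
    rw [mul_div_cancel₀ _ hβ.ne] at h2
    linarith
  rw [hL] at hLs
  have hdom : ∀ r, f r ≠ ⊤ → c < α * r + β * (f r).toReal := by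
    intro r hr
    have := hLA (r, (f r).toReal) ⟨ENNReal.toReal_nonneg, (ENNReal.ofReal_toReal hr).ge⟩
    rwa [hL] at this
  -- If `β = 0` the separating line is vertical: `c - α r` is negative on the domain of `f` and
  -- positive at `s`. Its multiple with value `|y| + 1` at `s` is then a minorant.
  rcases hβ.eq_or_lt with hβ0 | hβ0
  · rw [← hβ0] at hLs hdom
    have hpos : 0 < c - α * s := by linarith
    refine ⟨(|y| + 1) / (c - α * s) * c, -((|y| + 1) / (c - α * s) * α), fun r => ?_, ?_⟩
    · by_cases hr : f r = ⊤
      · simp [hr]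
      · rw [ENNReal.ofReal_of_nonpos]
        · exact zero_le
        have h1 := hdom r hr
        have h2 : (|y| + 1) / (c - α * s) * c + -((|y| + 1) / (c - α * s) * α) * r
          = (|y| + 1) / (c - α * s) * (c - α * r) := by ring
        rw [h2]
        exact mul_nonpos_of_nonneg_of_nonpos (by positivity) (by linarith)
    · have h2 : (|y| + 1) / (c - α * s) * c + -((|y| + 1) / (c - α * s) * α) * s
          = |y| + 1 := by field_simp; ring
      rw [h2]
      linarith [le_abs_self y]
  · refine ⟨c / β, -(α / β), fun r => ?_, ?_⟩
    · by_cases hr : f r = ⊤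
      · simp [hr]
      · rw [ENNReal.ofReal_le_iff_le_toReal hr]
        have h1 := hdom r hr
        have h2 : c / β + -(α / β) * r = (c - α * r) / β := by field_simp; ring
        rw [h2, div_le_iff₀ hβ0]
        linarith
    · have h2 : c / β + -(α / β) * s = (c - α * s) / β := by field_simp; ring
      rw [h2, lt_div_iff₀ hβ0]
      linarith

theorem affineMinorant_mul_le_recession {a b : ℝ}
    (hab : ∀ r, ENNReal.ofReal (a + b * r) ≤ f r) (t : ℝ) :
    ENNReal.ofReal (b * t) ≤ recession f t := by
  have h1 : Tendsto (fun s : ℝ => ENNReal.ofReal (a / s + b * t)) atTop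
      (𝓝 (ENNReal.ofReal (b * t))) := by
    refine ENNReal.tendsto_ofReal ?_
    have : Tendsto (fun s : ℝ => a / s) atTop (𝓝 0) := tendsto_const_nhds.div_atTop tendsto_id
    simpa using this.add_const (b * t)
  rw [← h1.limsup_eq]
  refine limsup_le_limsup ?_
  filter_upwards [eventually_gt_atTop 0] with s hs
  refine (ENNReal.le_div_iff_mul_le (Or.inl (by simpa using hs)) (Or.inl (by simp))).2 ?_
  rw [← ENNReal.ofReal_mul' hs.le]
  have : (a / s + b * t) * s = a + b * (s * t) := by field_simp
  rw [this]
  exact hab _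

/-- Every minorant has intercept at most `f 0`, so slopes with `b * t ≤ m` force `f (s t) ≤ f 0 + m
s`; dividing by `s` removes the constant. -/
theorem recession_le_of_affineMinorants (hf_convex : ConvexOn ℝ≥0 (univ : Set ℝ) f)
    (hf_lsc : LowerSemicontinuous f) (hf_zero : f 0 ≠ ⊤) {t m : ℝ}
    (h : ∀ a b : ℝ, (∀ r, ENNReal.ofReal (a + b * r) ≤ f r) → b * t ≤ m) :
    recession f t ≤ ENNReal.ofReal m := by
  have h1 : Tendsto (fun s : ℝ => ENNReal.ofReal ((f 0).toReal / s + m)) atTop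
      (𝓝 (ENNReal.ofReal m)) := by
    refine ENNReal.tendsto_ofReal ?_
    have : Tendsto (fun s : ℝ => (f 0).toReal / s) atTop (𝓝 0) :=
      tendsto_const_nhds.div_atTop tendsto_id
    simpa using this.add_const m
  rw [← h1.limsup_eq]
  refine limsup_le_limsup ?_
  filter_upwards [eventually_gt_atTop 0] with s hs
  refine ENNReal.div_le_of_le_mul ?_
  rw [← ENNReal.ofReal_mul' hs.le]
  have : ((f 0).toReal / s + m) * s = (f 0).toReal + m * s := by field_simp
  rw [this]
  by_contra hlt
  obtain ⟨a, b, hab, hlt⟩ :=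
    exists_affineMinorant_gt hf_convex hf_lsc hf_zero (not_le.1 hlt)
  have h2 : a ≤ (f 0).toReal := affineMinorants_fst_le (k := (a, b, 0)) hf_zero hab
  have h3 := mul_le_mul_of_nonneg_right (h a b hab) hs.le
  nlinarith

/-- The integrand dominates each of its linear minorants. -/
theorem ofReal_minorantForm_le {k : ℝ × ℝ × ℝ} (hk : k ∈ affineMinorants f) (θ : S1)
    (px : Plane) (pθ : ℝ) :
    ENNReal.ofReal (minorantForm k θ (px, pθ)) ≤ lineIntegrand f θ px pθ := by
  obtain ⟨a, b, e⟩ := k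
  unfold lineIntegrand
  rw [minorantForm_apply]
  split_ifs with h0 hc
  · simpa [h0] using affineMinorant_mul_le_recession hk pθ
  · obtain ⟨c, hc, rfl⟩ := hc
    have hu := norm_unitVec θ
    have hc0 : 0 < c := lt_of_le_of_ne hc fun h => h0 (by simp [← h])
    have hn : ‖c • unitVec θ‖ = c := by rw [norm_smul, hu, mul_one, Real.norm_of_nonneg hc]
    have h1 := hk (pθ / c)
    rw [hn]
    simp only [inner_smul_right, real_inner_self_eq_norm_sq, hu, inner_perp_self]
    calc _ = ENNReal.ofReal c * ENNReal.ofReal (a + b * (pθ / c)) := by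
          rw [← ENNReal.ofReal_mul hc]; congr 1; field_simp; ring
      _ ≤ _ := mul_le_mul_right h1 _
  · exact le_top

/-- The integrand is the supremum of its linear minorants. -/
theorem exists_minorantForm_gt (hf_convex : ConvexOn ℝ≥0 (univ : Set ℝ) f)
    (hf_lsc : LowerSemicontinuous f) (hf_zero : f 0 ≠ ⊤) (θ : S1) (px : Plane) (pθ y : ℝ)
    (hy0 : 0 ≤ y) (hy : ENNReal.ofReal y < lineIntegrand f θ px pθ) :
    ∃ k ∈ affineMinorants f, y < minorantForm k θ (px, pθ) := by
  unfold lineIntegrand at hy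
  simp only [minorantForm_apply]
  split_ifs at hy with h0 hc
  · by_contra! hcon
    refine not_le.2 hy (recession_le_of_affineMinorants hf_convex hf_lsc hf_zero ?_)
    intro a b hab
    simpa [h0] using hcon (a, b, 0) hab
  · obtain ⟨c, hc, rfl⟩ := hc
    have hu := norm_unitVec θ
    have hc0 : 0 < c := lt_of_le_of_ne hc fun h => h0 (by simp [← h])
    have hn : ‖c • unitVec θ‖ = c := by rw [norm_smul, hu, mul_one, Real.norm_of_nonneg hc]
    rw [hn] at hy
    have h2 : ENNReal.ofReal (y / c) < f (pθ / c) := by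
      rw [ENNReal.ofReal_div_of_pos hc0]
      refine (ENNReal.div_lt_iff (Or.inl (by simpa using hc0)) (Or.inl (by simp))).2 ?_
      rwa [mul_comm]
    obtain ⟨a, b, hab, h3⟩ := exists_affineMinorant_gt hf_convex hf_lsc hf_zero h2
    refine ⟨(a, b, 0), hab, ?_⟩
    simp only [inner_smul_right, real_inner_self_eq_norm_sq, hu, inner_perp_self]
    rw [div_lt_iff₀ hc0] at h3
    calc y < (a + b * (pθ / c)) * c := h3
      _ = _ := by field_simp; ring
  · by_cases hd : inner ℝ (perp (unitVec θ)) px = 0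
    · have hx := eq_smul_unitVec_of_inner_perp_eq_zero θ px hd
      set c := inner ℝ (unitVec θ) px with hcdef
      have hc0 : c < 0 := by
        by_contra hneg
        exact hc ⟨c, not_lt.1 hneg, hx⟩
      -- `px` points opposite to `unitVec θ`; the coefficient makes the form equal to `y + 1`.
      refine ⟨((y + 1) / c, 0, 0),
        zero_mem_affineMinorants _ _ (div_nonpos_of_nonneg_of_nonpos (by linarith) hc0.le), ?_⟩
      have : (y + 1) / c * c = y + 1 := div_mul_cancel₀ _ hc0.ne
      simp only [zero_mul, add_zero]
      linarith
    · refine ⟨(0, 0, (y + 1) / inner ℝ (perp (unitVec θ)) px),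
        zero_mem_affineMinorants _ _ le_rfl, ?_⟩
      have := div_mul_cancel₀ (y + 1) hd
      simp only [zero_mul, add_zero, zero_add]
      linarith

/-- The integrand is the supremum of countably many positive parts of linear forms. -/
theorem exists_seq_lineIntegrand_eq_iSup (hf_convex : ConvexOn ℝ≥0 (univ : Set ℝ) f)
    (hf_lsc : LowerSemicontinuous f) (hf_zero : f 0 ≠ ⊤) :
    ∃ k : ℕ → ℝ × ℝ × ℝ, ∀ θ px pθ,
      lineIntegrand f θ px pθ = ⨆ n, ENNReal.ofReal (minorantForm (k n) θ (px, pθ)) := by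
  -- The parameters form a separable space and the form is continuous in them, so a dense sequence
  -- has the same supremum.
  have : Nonempty (affineMinorants f) := ⟨⟨(0, 0, 0), zero_mem_affineMinorants _ _ le_rfl⟩⟩
  let k : ℕ → affineMinorants f := TopologicalSpace.denseSeq _
  have hk : DenseRange k := TopologicalSpace.denseRange_denseSeq _
  refine ⟨fun n => (k n : ℝ × ℝ × ℝ), fun θ px pθ => le_antisymm ?_
    (iSup_le fun n => ofReal_minorantForm_le (k n).2 θ px pθ)⟩
  refine le_of_forall_lt fun z hz => ?_
  have hzt : z ≠ ⊤ := (hz.trans_le le_top).ne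
  rw [← ENNReal.ofReal_toReal hzt] at hz
  obtain ⟨j, hj, hlt⟩ := exists_minorantForm_gt hf_convex hf_lsc hf_zero θ px pθ _
    ENNReal.toReal_nonneg hz
  have hcont : Continuous fun j : affineMinorants f => minorantForm (j : ℝ × ℝ × ℝ) θ (px, pθ) :=
    continuous_minorantForm.comp (f := fun j : affineMinorants f =>
      ((j : ℝ × ℝ × ℝ), θ, (px, pθ))) (by fun_prop)
  obtain ⟨n, hn⟩ := hk.exists_mem_open (isOpen_lt continuous_const hcont) ⟨⟨j, hj⟩, hlt⟩
  refine lt_of_lt_of_le ?_ (le_iSup _ n)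
  exact (ENNReal.lt_ofReal_iff_toReal_lt hzt).2 hn

/-- Off the cone the right side is `⊤`. On it, scaling `px = c • unitVec θ` changes each minorant by
`(t - 1) c a`, with `a ≤ f 0`. -/
theorem lineIntegrand_smul_le (hf_convex : ConvexOn ℝ≥0 (univ : Set ℝ) f)
    (hf_lsc : LowerSemicontinuous f) (hf_zero : f 0 ≠ ⊤) (θ : S1) (px : Plane) (pθ : ℝ)
    {t : ℝ} (ht : 1 ≤ t) :
    lineIntegrand f θ (t • px) pθ
      ≤ lineIntegrand f θ px pθ + ENNReal.ofReal ((t - 1) * ‖px‖) * f 0 := by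
  by_cases hc : ∃ c : ℝ, 0 ≤ c ∧ px = c • unitVec θ
  swap
  · have h0 : px ≠ 0 := fun h => hc ⟨0, le_rfl, by simp [h]⟩
    have : lineIntegrand f θ px pθ = ⊤ := by simp [lineIntegrand, h0, hc]
    simp [this]
  obtain ⟨c, hc, rfl⟩ := hc
  have hu := norm_unitVec θ
  have hn : ‖c • unitVec θ‖ = c := by rw [norm_smul, hu, mul_one, Real.norm_of_nonneg hc]
  rw [hn]
  refine le_of_forall_lt fun z hz => ?_
  have hzt : z ≠ ⊤ := (hz.trans_le le_top).ne
  rw [← ENNReal.ofReal_toReal hzt] at hz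
  obtain ⟨k, hk, hlt⟩ := exists_minorantForm_gt hf_convex hf_lsc hf_zero _ _ _ _
    ENNReal.toReal_nonneg hz
  have h1 := ofReal_minorantForm_le hk θ (c • unitVec θ) pθ
  have h2 := affineMinorants_fst_le hf_zero hk
  rw [minorantForm_apply] at hlt h1
  simp only [inner_smul_right, real_inner_self_eq_norm_sq, hu, inner_perp_self] at hlt h1
  refine lt_of_lt_of_le ?_ (add_le_add_left h1 _)
  rw [← ENNReal.ofReal_toReal hf_zero, ← ENNReal.ofReal_mul (mul_nonneg (by linarith) hc)]
  refine lt_of_lt_of_le ?_ ENNReal.ofReal_add_le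
  rw [ENNReal.lt_ofReal_iff_toReal_lt hzt]
  have h3 : (t - 1) * c * k.1 ≤ (t - 1) * c * (f 0).toReal :=
    mul_le_mul_of_nonneg_left h2 (mul_nonneg (by linarith) hc)
  nlinarith

theorem lineIntegrand_smul (θ : S1) (px : Plane) (pθ : ℝ) {r : ℝ}
    (hf_convex : ConvexOn ℝ≥0 (univ : Set ℝ) f)
    (hf_lsc : LowerSemicontinuous f) (hf_zero : f 0 ≠ ⊤) (hr : 0 ≤ r) :
    lineIntegrand f θ (r • px) (r * pθ) = ENNReal.ofReal r * lineIntegrand f θ px pθ := by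
  obtain ⟨k, hk⟩ := exists_seq_lineIntegrand_eq_iSup hf_convex hf_lsc hf_zero
  rw [hk, hk, ENNReal.mul_iSup]
  congr 1 with n
  rw [← ENNReal.ofReal_mul hr, show ((r • px, r * pθ) : Plane × ℝ) = r • (px, pθ) from rfl,
    map_smul, smul_eq_mul]

theorem measurable_lineIntegrand (hf_convex : ConvexOn ℝ≥0 (univ : Set ℝ) f)
    (hf_lsc : LowerSemicontinuous f) (hf_zero : f 0 ≠ ⊤) :
    Measurable fun z : S1 × (Plane × ℝ) => lineIntegrand f z.1 z.2.1 z.2.2 := by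
  obtain ⟨k, hk⟩ := exists_seq_lineIntegrand_eq_iSup hf_convex hf_lsc hf_zero
  simp only [hk]
  refine Measurable.iSup fun n => ENNReal.measurable_ofReal.comp (Continuous.measurable ?_)
  exact continuous_minorantForm.comp (f := fun z : S1 × (Plane × ℝ) => (k n, z)) (by fun_prop)

theorem le_lineIntegrand {γ : ℝ} (hγ : 0 < γ)
    (hf : ∀ t : ℝ, ENNReal.ofReal (γ * Real.sqrt (1 + t ^ 2)) ≤ f t) (θ : S1) (px : Plane)
    (pθ : ℝ) (hp : ‖px‖ ^ 2 + pθ ^ 2 = 1) : ENNReal.ofReal γ ≤ lineIntegrand f θ px pθ := by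
  unfold lineIntegrand
  split_ifs with h0 hc
  · have h1 : pθ ^ 2 = 1 := by simpa [h0] using hp
    -- With `|pθ| = 1`, the slope `γ * pθ` gives a linear minorant, whose recession value at `pθ` is
    -- `γ`.
    have h2 : ∀ r, ENNReal.ofReal (0 + γ * pθ * r) ≤ f r := by
      intro r
      refine le_trans (ENNReal.ofReal_le_ofReal ?_) (hf r)
      rw [zero_add, mul_assoc]
      refine mul_le_mul_of_nonneg_left (Real.le_sqrt_of_sq_le ?_) hγ.le
      rw [mul_pow, h1]; linarith
    have h3 := affineMinorant_mul_le_recession h2 pθ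
    rwa [mul_assoc, ← sq, h1, mul_one] at h3
  · have hn : 0 < ‖px‖ := norm_pos_iff.2 h0
    refine le_trans ?_ (mul_le_mul_right (hf _) _)
    rw [← ENNReal.ofReal_mul hn.le]
    refine ENNReal.ofReal_le_ofReal ?_
    have h1 : 1 + (pθ / ‖px‖) ^ 2 = (1 / ‖px‖) ^ 2 := by
      field_simp; linarith
    rw [h1, Real.sqrt_sq (by positivity)]
    apply le_of_eq; field_simp
  · exact le_top

end Integrand
end RotoTranslation

/-! ### Jensen's inequality and barycenters -/

namespace RotoTranslation
variable {f : ℝ → ℝ≥0∞}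

theorem ofReal_integral_le_lintegral_ofReal {α : Type*} [MeasurableSpace α] {μ : Measure α}
    {g : α → ℝ} (hg : Integrable g μ) :
    ENNReal.ofReal (∫ x, g x ∂μ) ≤ ∫⁻ x, ENNReal.ofReal (g x) ∂μ := by
  calc ENNReal.ofReal (∫ x, g x ∂μ) ≤ ENNReal.ofReal (∫ x, max (g x) 0 ∂μ) :=
        ENNReal.ofReal_le_ofReal (integral_mono hg hg.pos_part fun x => le_max_left _ _)
    _ = ∫⁻ x, ENNReal.ofReal (max (g x) 0) ∂μ :=
        ofReal_integral_eq_lintegral_ofReal hg.pos_part (ae_of_all _ fun x => le_max_right _ _)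
    _ = _ := by simp [ENNReal.ofReal_max]

/-- Jensen's inequality for the integrand. -/
theorem lineIntegrand_integral_le (hf_convex : ConvexOn ℝ≥0 (univ : Set ℝ) f)
    (hf_lsc : LowerSemicontinuous f) (hf_zero : f 0 ≠ ⊤) (θ : S1) {κ : Measure (Plane × ℝ)}
    (hκ : Integrable (fun p : Plane × ℝ => p) κ) :
    lineIntegrand f θ (∫ p, p ∂κ).1 (∫ p, p ∂κ).2 ≤ ∫⁻ p, lineIntegrand f θ p.1 p.2 ∂κ := by
  obtain ⟨k, hk⟩ := exists_seq_lineIntegrand_eq_iSup hf_convex hf_lsc hf_zero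
  rw [hk]
  refine iSup_le fun n => ?_
  rw [← ContinuousLinearMap.integral_comp_comm _ hκ]
  refine (ofReal_integral_le_lintegral_ofReal
    ((minorantForm (k n) θ).integrable_comp hκ)).trans (lintegral_mono fun p => ?_)
  rw [hk]
  exact le_iSup (fun n => ENNReal.ofReal (minorantForm (k n) θ p)) n

/-- The Euclidean norm on `Plane × ℝ`. -/
noncomputable def euclNorm (p : Plane × ℝ) : ℝ := Real.sqrt (‖p.1‖ ^ 2 + p.2 ^ 2)

theorem continuous_euclNorm : Continuous euclNorm := by unfold euclNorm; fun_prop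

theorem euclNorm_eq_zero {p : Plane × ℝ} (h : euclNorm p = 0) : p = 0 := by
  have h1 : ‖p.1‖ ^ 2 + p.2 ^ 2 = 0 := (Real.sqrt_eq_zero (by positivity)).1 h
  have h2 : ‖p.1‖ = 0 := by nlinarith [sq_nonneg ‖p.1‖, sq_nonneg p.2]
  have h3 : p.2 = 0 := by nlinarith [sq_nonneg ‖p.1‖, sq_nonneg p.2]
  exact Prod.ext (norm_eq_zero.1 h2) h3

theorem euclNorm_smul_inv_smul (p : Plane × ℝ) : euclNorm p • ((euclNorm p)⁻¹ • p) = p := by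
  by_cases h : euclNorm p = 0
  · rw [euclNorm_eq_zero h]; simp
  · exact smul_inv_smul₀ h p

theorem sq_norm_inv_euclNorm_smul {p : Plane × ℝ} (h : euclNorm p ≠ 0) :
    ‖((euclNorm p)⁻¹ • p).1‖ ^ 2 + ((euclNorm p)⁻¹ • p).2 ^ 2 = 1 := by
  have h1 : euclNorm p ^ 2 = ‖p.1‖ ^ 2 + p.2 ^ 2 := Real.sq_sqrt (by positivity)
  simp only [Prod.smul_fst, Prod.smul_snd, norm_smul, smul_eq_mul, mul_pow, norm_inv,
    Real.norm_eq_abs, inv_pow, sq_abs]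
  rw [← mul_add, ← h1]
  exact inv_mul_cancel₀ (pow_ne_zero 2 h)

/-- A finite measure on position-vector pairs has a barycentric vector measure: it has the same
integrals of fields of linear forms supported in `Ω × S1`, and no more energy. -/
theorem exists_barycenter (hf_convex : ConvexOn ℝ≥0 (univ : Set ℝ) f)
    (hf_lsc : LowerSemicontinuous f) (hf_zero : f 0 ≠ ⊤) {Ω : Set Plane} (hΩ : MeasurableSet Ω)
    (μ : Measure ((Plane × S1) × (Plane × ℝ))) [IsFiniteMeasure μ]
    (hμ : Integrable (fun z : (Plane × S1) × (Plane × ℝ) => z.2) μ) :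
    ∃ σ : VectorRadonMeasure Ω,
      (∀ G : Plane × S1 → (Plane × ℝ →L[ℝ] ℝ), Continuous G → (∃ C, ∀ q, ‖G q‖ ≤ C) →
        (∀ q, q.1 ∉ Ω → G q = 0) →
        ∫ q, G q (σ.dirX q, σ.dirθ q) ∂σ.tv = ∫ z, G z.1 z.2 ∂μ) ∧
      σ.energy f ≤ ∫⁻ z, lineIntegrand f z.1.2 z.2.1 z.2.2 ∂μ := by
  -- Disintegrate over positions: `b q` is the mean vector at `q`, and the measure sought is `b ν`
  -- restricted to `Ω × S1`, put in polar form.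
  set ν := μ.fst with hν
  set κ := μ.condKernel with hκ
  have hdis : ν.compProd κ = μ := μ.disintegrate κ
  set b : Plane × S1 → Plane × ℝ := fun q => ∫ p, p ∂(κ q) with hb
  have hbm : Measurable b :=
    (StronglyMeasurable.integral_kernel_prod_right' (κ := κ)
      (f := fun z : (Plane × S1) × (Plane × ℝ) => z.2) measurable_snd.stronglyMeasurable).measurable
  have hint : ∀ᵐ q ∂ν, Integrable (fun p : Plane × ℝ => p) (κ q) := by
    rw [← hdis] at hμ
    exact ((Measure.integrable_compProd_iff hμ.1).1 hμ).1
  have hbi : Integrable b ν := by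
    rw [← hdis] at hμ
    exact ((Measure.integrable_compProd_iff hμ.1).1 hμ).2.mono' hbm.aestronglyMeasurable
      (ae_of_all _ fun q => norm_integral_le_integral_norm _)
  set N : Plane × S1 → ℝ≥0 := fun q => (euclNorm (b q)).toNNReal with hN
  have hN' : ∀ q, (N q : ℝ) = euclNorm (b q) := fun q => Real.coe_toNNReal _ (Real.sqrt_nonneg _)
  have hNm : Measurable N := (continuous_euclNorm.measurable.comp hbm).real_toNNReal
  set d : Plane × S1 → Plane × ℝ := fun q => (euclNorm (b q))⁻¹ • b q with hd
  have hdm : Measurable d := (continuous_euclNorm.measurable.comp hbm).inv.smul hbm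
  have hS : MeasurableSet (Ω ×ˢ (univ : Set S1)) := hΩ.prod MeasurableSet.univ
  -- The Euclidean length of `b` becomes the mass density. The restriction drops mass outside `Ω`,
  -- which the fields `G` do not see and which only lowers the energy.
  set τ : Measure (Plane × S1) :=
    (ν.restrict (Ω ×ˢ univ)).withDensity (fun q => (N q : ℝ≥0∞)) with hτ
  have hτfin : IsFiniteMeasure τ := by
    refine isFiniteMeasure_withDensity ?_
    have h1 : Integrable (fun q => ‖(b q).1‖ + ‖(b q).2‖) ν := hbi.fst.norm.add hbi.snd.norm
    have h2 : ∫⁻ q, ENNReal.ofReal (‖(b q).1‖ + ‖(b q).2‖) ∂ν < ⊤ :=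
      (hasFiniteIntegral_iff_ofReal (ae_of_all _ fun q => by positivity)).1 h1.2
    refine ((lintegral_mono' Measure.restrict_le_self fun q => ?_).trans_lt h2).ne
    rw [hN, ← ENNReal.ofReal]
    refine ENNReal.ofReal_le_ofReal (Real.sqrt_le_iff.2 ⟨by positivity, ?_⟩)
    rw [Real.norm_eq_abs]
    nlinarith [norm_nonneg (b q).1, abs_nonneg (b q).2, sq_abs (b q).2]
  let σ : VectorRadonMeasure Ω :=
    { tv := τ
      finite_tv := hτfin
      tv_compl := by
        refine withDensity_absolutelyContinuous _ _ ?_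
        rw [Measure.restrict_apply hS.compl]; simp
      dirX := fun q => (d q).1
      dirθ := fun q => (d q).2
      measurable_dirX := hdm.fst
      measurable_dirθ := hdm.snd
      norm_dir := by
        rw [hτ, ae_withDensity_iff (by fun_prop)]
        refine ae_of_all _ fun q hq => sq_norm_inv_euclNorm_smul ?_
        rw [← hN']
        simpa using hq }
  refine ⟨σ, ?_, ?_⟩
  · rintro G hG ⟨C, hC⟩ hG0
    have hGint : Integrable (fun z : (Plane × S1) × (Plane × ℝ) => G z.1 z.2) μ := by
      refine (hμ.norm.const_mul C).mono' ?_ (ae_of_all _ fun z => ?_)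
      · exact Continuous.aestronglyMeasurable (by fun_prop)
      · exact (G z.1).le_of_opNorm_le (hC _) _
    have e1 : ∫ z, G z.1 z.2 ∂μ = ∫ q, G q (b q) ∂ν := by
      conv_lhs => rw [← hdis]
      rw [Measure.integral_compProd (by rwa [hdis])]
      refine integral_congr_ae ?_
      filter_upwards [hint] with q hq
      exact (G q).integral_comp_comm hq
    rw [e1]
    change ∫ q, G q (d q) ∂τ = _
    rw [hτ, integral_withDensity_eq_integral_smul hNm]
    have e2 : ∀ q, N q • G q (d q) = G q (b q) := by
      intro q
      rw [NNReal.smul_def, hN', ← map_smul, hd, euclNorm_smul_inv_smul]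
    simp_rw [e2]
    refine setIntegral_eq_integral_of_forall_compl_eq_zero fun q hq => ?_
    rw [hG0 q (fun h => hq ⟨h, trivial⟩)]; rfl
  · have hm := measurable_lineIntegrand hf_convex hf_lsc hf_zero
    change ∫⁻ q, lineIntegrand f q.2 (d q).1 (d q).2 ∂τ ≤ _
    have hmd : Measurable fun q => lineIntegrand f q.2 (d q).1 (d q).2 :=
      hm.comp (measurable_snd.prodMk hdm)
    rw [hτ, lintegral_withDensity_eq_lintegral_mul _ hNm.coe_nnreal_ennreal hmd]
    calc _ ≤ ∫⁻ q, lineIntegrand f q.2 (b q).1 (b q).2 ∂ν := by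
          refine lintegral_mono' Measure.restrict_le_self fun q => le_of_eq ?_
          have h1 := lineIntegrand_smul q.2 (d q).1 (d q).2 hf_convex hf_lsc hf_zero
            (Real.sqrt_nonneg (‖(b q).1‖ ^ 2 + (b q).2 ^ 2))
          have h2 := euclNorm_smul_inv_smul (b q)
          have h3 : euclNorm (b q) • (d q).1 = (b q).1 := congrArg Prod.fst h2
          have h4 : euclNorm (b q) * (d q).2 = (b q).2 := congrArg Prod.snd h2
          change lineIntegrand f q.2 (euclNorm (b q) • (d q).1) (euclNorm (b q) * (d q).2)
            = ENNReal.ofReal (euclNorm (b q)) * _ at h1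
          rw [h3, h4] at h1
          exact h1.symm
      _ ≤ ∫⁻ q, ∫⁻ p, lineIntegrand f q.2 p.1 p.2 ∂(κ q) ∂ν := by
          refine lintegral_mono_ae ?_
          filter_upwards [hint] with q hq
          exact lineIntegrand_integral_le hf_convex hf_lsc hf_zero q.2 hq
      _ = _ := by
          conv_rhs => rw [← hdis]
          rw [Measure.lintegral_compProd]
          exact hm.comp (f := fun z : (Plane × S1) × (Plane × ℝ) => (z.1.2, z.2))
            (by fun_prop)

end RotoTranslation

/-! ### Test functions, test fields and dilations -/

namespace RotoTranslation
variable {Ω : Set Plane}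

/-- The differential of a function on `Plane × S1`, as a linear form on `Plane × ℝ`. -/
noncomputable def testDiff (ψ : Plane × S1 → ℝ) (q : Plane × S1) : Plane × ℝ →L[ℝ] ℝ :=
  (fderiv ℝ (fun y : Plane => ψ (y, q.2)) q.1).comp (ContinuousLinearMap.fst ℝ Plane ℝ) +
    deriv (fun t : ℝ => ψ (q.1, q.2 + (t : S1))) 0 • ContinuousLinearMap.snd ℝ Plane ℝ

theorem testDiff_apply (ψ : Plane × S1 → ℝ) (q : Plane × S1) (p : Plane × ℝ) :
    testDiff ψ q p = fderiv ℝ (fun y : Plane => ψ (y, q.2)) q.1 p.1 +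
      deriv (fun t : ℝ => ψ (q.1, q.2 + (t : S1))) 0 * p.2 := by
  simp [testDiff]

theorem VectorRadonMeasure.divFree_iff (σ : VectorRadonMeasure Ω) :
    σ.DivFree ↔ ∀ ψ, IsTestFunction Ω ψ →
      ∫ q, testDiff ψ q (σ.dirX q, σ.dirθ q) ∂σ.tv = 0 := by
  simp only [testDiff_apply]
  rfl

theorem testDiff_coe {ψ : Plane × S1 → ℝ}
    (hψ : ContDiff ℝ 1 (fun q : Plane × ℝ => ψ (q.1, (q.2 : S1)))) (x : Plane) (t : ℝ) :
    testDiff ψ (x, (t : S1)) = fderiv ℝ (fun q : Plane × ℝ => ψ (q.1, (q.2 : S1))) (x, t) := by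
  set Ψ := fun q : Plane × ℝ => ψ (q.1, (q.2 : S1)) with hΨ
  have hd : HasFDerivAt Ψ (fderiv ℝ Ψ (x, t)) (x, t) :=
    (hψ.differentiable one_ne_zero).differentiableAt.hasFDerivAt
  have h1 : HasFDerivAt (fun y : Plane => ψ (y, (t : S1)))
      ((fderiv ℝ Ψ (x, t)).comp (ContinuousLinearMap.inl ℝ Plane ℝ)) x :=
    hd.comp (f := fun y : Plane => (y, t)) x (hasFDerivAt_prodMk_left x t)
  have h2 : HasDerivAt (fun s : ℝ => ψ (x, (t : S1) + (s : S1))) (fderiv ℝ Ψ (x, t) (0, 1)) 0 := by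
    have h3 : HasDerivAt (fun s : ℝ => (x, t + s)) ((0 : Plane), (1 : ℝ)) 0 :=
      (hasDerivAt_const _ _).prodMk ((hasDerivAt_id _).const_add t)
    have h4 : HasFDerivAt Ψ (fderiv ℝ Ψ (x, t)) (x, t + 0) := by rwa [add_zero]
    exact h4.comp_hasDerivAt (0 : ℝ) h3
  ext p
  · simp [testDiff_apply, h1.fderiv]
  · simp [testDiff_apply, h2.deriv]

/-- Continuity is checked on the cover `Plane × ℝ`, where the differential is the ordinary `fderiv`
of the lift; the open quotient map brings it down. -/
theorem IsTestFunction.continuous_testDiff {ψ : Plane × S1 → ℝ} (hψ : IsTestFunction Ω ψ) :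
    Continuous (testDiff ψ) := by
  have hq : IsOpenQuotientMap (Prod.map id (fun t : ℝ => (t : S1)) : Plane × ℝ → Plane × S1) :=
    IsOpenQuotientMap.id.prodMap QuotientAddGroup.isOpenQuotientMap_mk
  rw [hq.isQuotientMap.continuous_iff]
  have : testDiff ψ ∘ Prod.map id (fun t : ℝ => (t : S1))
      = fderiv ℝ (fun q : Plane × ℝ => ψ (q.1, (q.2 : S1))) := by
    ext1 q
    exact testDiff_coe hψ.1 q.1 q.2
  rw [this]
  exact hψ.1.continuous_fderiv one_ne_zero

theorem testDiff_eq_zero {ψ : Plane × S1 → ℝ} {q : Plane × S1} (hq : q ∉ tsupport ψ) :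
    testDiff ψ q = 0 := by
  have h0 : ψ =ᶠ[𝓝 q] 0 := notMem_tsupport_iff_eventuallyEq.1 hq
  have h1 : (fun y : Plane => ψ (y, q.2)) =ᶠ[𝓝 q.1] fun _ => 0 := by
    have : Tendsto (fun y : Plane => (y, q.2)) (𝓝 q.1) (𝓝 q) :=
      Continuous.tendsto' (by fun_prop) _ _ rfl
    exact this.eventually h0
  have h2 : (fun t : ℝ => ψ (q.1, q.2 + (t : S1))) =ᶠ[𝓝 0] fun _ => 0 := by
    have : Tendsto (fun t : ℝ => (q.1, q.2 + (t : S1))) (𝓝 0) (𝓝 q) := by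
      refine Continuous.tendsto' ?_ _ _ (by simp)
      exact continuous_const.prodMk (continuous_const.add (AddCircle.continuous_mk' _))
    exact this.eventually h0
  ext p <;> simp [testDiff_apply, h1.fderiv_eq, h2.deriv_eq]

theorem IsTestFunction.testDiff_eq_zero {ψ : Plane × S1 → ℝ} (hψ : IsTestFunction Ω ψ)
    {q : Plane × S1} (hq : q.1 ∉ Ω) : testDiff ψ q = 0 :=
  RotoTranslation.testDiff_eq_zero fun h => hq (hψ.2.2 h).1

theorem IsTestFunction.exists_norm_testDiff_le {ψ : Plane × S1 → ℝ} (hψ : IsTestFunction Ω ψ) :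
    ∃ C, ∀ q, ‖testDiff ψ q‖ ≤ C := by
  refine hψ.continuous_testDiff.bounded_above_of_compact_support ?_
  refine HasCompactSupport.intro hψ.2.1 fun q hq => RotoTranslation.testDiff_eq_zero hq

/-- The linear form on `Plane × ℝ` against which the marginal constraint is tested. -/
noncomputable def fieldForm (φ : Plane → Plane) (q : Plane × S1) : Plane × ℝ →L[ℝ] ℝ :=
  (innerSL ℝ (perp (φ q.1))).comp (ContinuousLinearMap.fst ℝ Plane ℝ)

theorem fieldForm_apply (φ : Plane → Plane) (q : Plane × S1) (p : Plane × ℝ) :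
    fieldForm φ q p = inner ℝ (perp (φ q.1)) p.1 := by simp [fieldForm]

theorem perp_zero : perp 0 = 0 := by ext i; fin_cases i <;> simp [perp]

theorem IsTestField.continuous_fieldForm {φ : Plane → Plane} (hφ : IsTestField Ω φ) :
    Continuous (fieldForm φ) := by
  have h1 : Continuous fun q : Plane × S1 => perp (φ q.1) :=
    continuous_perp.comp (hφ.1.continuous.comp continuous_fst)
  exact ((innerSL ℝ).continuous.comp h1).clm_comp continuous_const

theorem IsTestField.fieldForm_eq_zero {φ : Plane → Plane} (hφ : IsTestField Ω φ)
    {q : Plane × S1} (hq : q.1 ∉ Ω) : fieldForm φ q = 0 := by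
  have : φ q.1 = 0 := image_eq_zero_of_notMem_tsupport fun h => hq (hφ.2.2 h)
  simp [fieldForm, this, perp_zero]

theorem IsTestField.exists_norm_fieldForm_le {φ : Plane → Plane} (hφ : IsTestField Ω φ) :
    ∃ C, ∀ q, ‖fieldForm φ q‖ ≤ C := by
  obtain ⟨C, hC⟩ := hφ.1.continuous.bounded_above_of_compact_support hφ.2.1
  refine ⟨C, fun q => ContinuousLinearMap.opNorm_le_bound _ ((norm_nonneg _).trans (hC 0))
    fun p => ?_⟩
  rw [fieldForm_apply]
  refine (norm_inner_le_norm _ _).trans ?_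
  rw [norm_perp]
  exact mul_le_mul (hC _) (norm_fst_le p) (norm_nonneg _) ((norm_nonneg _).trans (hC 0))

theorem IsTestField.continuous_divergence {φ : Plane → Plane} (hφ : IsTestField Ω φ) :
    Continuous (divergence φ) := by
  unfold divergence
  have h := hφ.1.continuous_fderiv one_ne_zero
  refine continuous_finsetSum _ fun i _ => ?_
  have h1 : Continuous fun x => fderiv ℝ φ x (EuclideanSpace.single i 1) :=
    h.clm_apply continuous_const
  fun_prop

theorem IsTestField.hasCompactSupport_divergence {φ : Plane → Plane} (hφ : IsTestField Ω φ) :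
    HasCompactSupport (divergence φ) := by
  refine (hφ.2.1.fderiv (𝕜 := ℝ)).mono fun x hx => ?_
  contrapose! hx
  simp [divergence, Function.notMem_support.1 hx]

theorem IsTestField.divergence_eq_zero {φ : Plane → Plane} (hφ : IsTestField Ω φ)
    {x : Plane} (hx : x ∉ Ω) : divergence φ x = 0 := by
  have : fderiv ℝ φ x = 0 := by
    by_contra h
    exact hx (hφ.2.2 (support_fderiv_subset ℝ h))
  simp [divergence, this]

/-- The dilation of ratio `t` centered at `y`. -/
noncomputable def dilation (t : ℝ) (y x : Plane) : Plane := t • x - (t - 1) • y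

theorem continuous_dilation (t : ℝ) : Continuous fun z : Plane × Plane => dilation t z.1 z.2 := by
  unfold dilation; fun_prop

theorem hasFDerivAt_dilation (t : ℝ) (y x : Plane) :
    HasFDerivAt (dilation t y) (t • ContinuousLinearMap.id ℝ Plane) x :=
  ((hasFDerivAt_id x).const_smul t).sub_const _

/-- The dilation as a homeomorphism. -/
noncomputable def dilationHomeomorph {t : ℝ} (ht : t ≠ 0) (y : Plane) : Plane ≃ₜ Plane :=
  (Homeomorph.smulOfNeZero t ht).trans (Homeomorph.subRight ((t - 1) • y))

/-- `x` is a convex combination of the center `y` and its own dilate. This is where convexity of `Ω`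
enters. -/
theorem mem_of_dilation_mem (hΩ : Convex ℝ Ω) {t : ℝ} (ht : 1 ≤ t) {x y : Plane} (hy : y ∈ Ω)
    (hx : dilation t y x ∈ Ω) : x ∈ Ω := by
  have h0 : 0 < t := by linarith
  have h1 : x = t⁻¹ • dilation t y x + (1 - t⁻¹) • y := by
    rw [dilation, smul_sub, inv_smul_smul₀ h0.ne', smul_smul, sub_add, ← sub_smul]
    have : t⁻¹ * (t - 1) - (1 - t⁻¹) = 0 := by field_simp; ring
    rw [this, zero_smul, sub_zero]
  rw [h1]
  exact hΩ hx hy (by positivity) (sub_nonneg.2 (inv_le_one_of_one_le₀ ht)) (by ring)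

theorem IsTestFunction.comp_dilation {ψ : Plane × S1 → ℝ} (hψ : IsTestFunction Ω ψ)
    (hΩ : Convex ℝ Ω) {t : ℝ} (ht : 1 ≤ t) {y : Plane} (hy : y ∈ Ω) :
    IsTestFunction Ω (fun q => ψ (dilation t y q.1, q.2)) := by
  have h0 : t ≠ 0 := by linarith
  let H := (dilationHomeomorph h0 y).prodCongr (Homeomorph.refl S1)
  have hH : (fun q : Plane × S1 => ψ (dilation t y q.1, q.2)) = ψ ∘ H := rfl
  refine ⟨?_, ?_, ?_⟩
  · have : ContDiff ℝ 1 fun q : Plane × ℝ => (dilation t y q.1, q.2) := by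
      unfold dilation; fun_prop
    exact hψ.1.comp this
  · rw [hH]; exact hψ.2.1.comp_homeomorph H
  · rw [hH]
    intro q hq
    have h1 := hψ.2.2 (tsupport_comp_subset_preimage ψ H.continuous hq)
    exact ⟨mem_of_dilation_mem hΩ ht hy h1.1, trivial⟩

/-- The chain rule puts a factor `t` on the spatial component only, which dictates how the vectors
of a dilated measure must be rescaled. -/
theorem IsTestFunction.testDiff_comp_dilation {ψ : Plane × S1 → ℝ} (hψ : IsTestFunction Ω ψ)
    (t : ℝ) (y : Plane) (q : Plane × S1) (p : Plane × ℝ) :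
    testDiff (fun q => ψ (dilation t y q.1, q.2)) q p
      = testDiff ψ (dilation t y q.1, q.2) (t • p.1, p.2) := by
  obtain ⟨x, θ⟩ := q
  obtain ⟨s, rfl⟩ := QuotientAddGroup.mk_surjective θ
  have hd : HasFDerivAt (fun x : Plane => ψ (x, (s : S1)))
      (fderiv ℝ (fun x : Plane => ψ (x, (s : S1))) (dilation t y x)) (dilation t y x) := by
    have h1 : ContDiff ℝ 1 fun x : Plane => ψ (x, (s : S1)) :=
      hψ.1.comp (f := fun x : Plane => (x, s)) (by fun_prop)
    exact (h1.differentiable one_ne_zero).differentiableAt.hasFDerivAt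
  have h2 := (hd.comp x (hasFDerivAt_dilation t y x)).fderiv
  rw [testDiff_apply, testDiff_apply]
  change fderiv ℝ ((fun x : Plane => ψ (x, (s : S1))) ∘ dilation t y) x p.1 + _ = _
  rw [h2]
  simp

theorem IsTestField.comp_dilation {φ : Plane → Plane} (hφ : IsTestField Ω φ)
    (hΩ : Convex ℝ Ω) {t : ℝ} (ht : 1 ≤ t) {y : Plane} (hy : y ∈ Ω) :
    IsTestField Ω (fun x => φ (dilation t y x)) := by
  have h0 : t ≠ 0 := by linarith
  have hH : (fun x => φ (dilation t y x)) = φ ∘ dilationHomeomorph h0 y := rfl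
  refine ⟨?_, ?_, ?_⟩
  · have : ContDiff ℝ 1 (dilation t y) := by unfold dilation; fun_prop
    exact hφ.1.comp this
  · rw [hH]; exact hφ.2.1.comp_homeomorph _
  · rw [hH]
    intro q hq
    have h1 := hφ.2.2 (tsupport_comp_subset_preimage φ (dilationHomeomorph h0 y).continuous hq)
    exact mem_of_dilation_mem hΩ ht hy h1

theorem IsTestField.divergence_comp_dilation {φ : Plane → Plane} (hφ : IsTestField Ω φ)
    (t : ℝ) (y x : Plane) :
    divergence (fun x => φ (dilation t y x)) x = t * divergence φ (dilation t y x) := by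
  have hd : HasFDerivAt φ (fderiv ℝ φ (dilation t y x)) (dilation t y x) :=
    (hφ.1.differentiable one_ne_zero).differentiableAt.hasFDerivAt
  have h2 := (hd.comp x (hasFDerivAt_dilation t y x)).fderiv
  unfold divergence
  change ∑ i, fderiv ℝ (φ ∘ dilation t y) x (EuclideanSpace.single i 1) i = _
  rw [h2, Finset.mul_sum]
  simp

end RotoTranslation

/-! ### Lifted measures and lower semicontinuity -/

namespace RotoTranslation
variable {f : ℝ → ℝ≥0∞} {Ω : Set Plane}

/-- Pairs of a position in `Plane × S1` and a vector. -/
abbrev PosVec : Type := (Plane × S1) × (Plane × ℝ)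

/-- A measure on position-vector pairs satisfies the constraints which define the admissible
vector measures for `u`. -/
def IsAdmissibleLift (Ω : Set Plane) (u : Plane → ℝ)
    (μ : Measure PosVec) : Prop :=
  (∀ ψ, IsTestFunction Ω ψ → ∫ z, testDiff ψ z.1 z.2 ∂μ = 0) ∧
    ∀ φ, IsTestField Ω φ → ∫ z, fieldForm φ z.1 z.2 ∂μ = -∫ x in Ω, u x * divergence φ x

/-- Relaxing vector measures to measures on pairs does not lower the infimum: the barycenter
satisfies the same constraints with no more energy. -/
theorem IsAdmissibleLift.totalRTVariation_le (hf_convex : ConvexOn ℝ≥0 (univ : Set ℝ) f)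
    (hf_lsc : LowerSemicontinuous f) (hf_zero : f 0 ≠ ⊤) (hΩ : MeasurableSet Ω) {u : Plane → ℝ}
    {μ : Measure PosVec} [IsFiniteMeasure μ]
    (h : IsAdmissibleLift Ω u μ)
    (hμ : Integrable (fun z : PosVec => z.2) μ) :
    totalRTVariation f Ω u ≤ ∫⁻ z, lineIntegrand f z.1.2 z.2.1 z.2.2 ∂μ := by
  obtain ⟨σ, hσ, hE⟩ := exists_barycenter hf_convex hf_lsc hf_zero hΩ μ hμ
  refine le_trans (iInf₂_le_of_le σ ?_ (iInf_le_of_le ?_ le_rfl)) hE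
  · rw [σ.divFree_iff]
    intro ψ hψ
    rw [hσ _ hψ.continuous_testDiff hψ.exists_norm_testDiff_le fun q => hψ.testDiff_eq_zero]
    exact h.1 ψ hψ
  · intro φ hφ
    have := hσ _ hφ.continuous_fieldForm hφ.exists_norm_fieldForm_le
      fun q => hφ.fieldForm_eq_zero
    simp only [fieldForm_apply] at this
    rw [this]
    simpa only [fieldForm_apply] using h.2 φ hφ

namespace VectorRadonMeasure

instance (σ : VectorRadonMeasure Ω) : IsFiniteMeasure σ.tv := σ.finite_tv

/-- The density of a vector measure with respect to its total variation. -/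
def dir (σ : VectorRadonMeasure Ω) (q : Plane × S1) : Plane × ℝ := (σ.dirX q, σ.dirθ q)

theorem measurable_dir (σ : VectorRadonMeasure Ω) : Measurable σ.dir :=
  σ.measurable_dirX.prodMk σ.measurable_dirθ

theorem norm_dirX_le (σ : VectorRadonMeasure Ω) : ∀ᵐ q ∂σ.tv, ‖σ.dirX q‖ ≤ 1 := by
  filter_upwards [σ.norm_dir] with q hq
  nlinarith [norm_nonneg (σ.dirX q), sq_nonneg (σ.dirθ q)]

theorem norm_dir_le (σ : VectorRadonMeasure Ω) : ∀ᵐ q ∂σ.tv, ‖σ.dir q‖ ≤ 1 := by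
  filter_upwards [σ.norm_dir, σ.norm_dirX_le] with q hq hx
  refine max_le hx ?_
  rw [dir, Real.norm_eq_abs]
  refine abs_le_one_iff_mul_self_le_one.2 ?_
  nlinarith [sq_nonneg ‖σ.dirX q‖]

theorem ae_mem (σ : VectorRadonMeasure Ω) : ∀ᵐ q ∂σ.tv, q.1 ∈ Ω := by
  have h : ∀ᵐ q ∂σ.tv, q ∈ Ω ×ˢ (univ : Set S1) := mem_ae_iff.2 σ.tv_compl
  filter_upwards [h] with q hq using hq.1

theorem measurable_graph (σ : VectorRadonMeasure Ω) : Measurable fun q => (q, σ.dir q) :=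
  measurable_id.prodMk σ.measurable_dir

/-- The measure on position-vector pairs carried by the graph of the density. -/
noncomputable def lift (σ : VectorRadonMeasure Ω) : Measure PosVec :=
  σ.tv.map fun q => (q, σ.dir q)

instance (σ : VectorRadonMeasure Ω) : IsFiniteMeasure σ.lift := by unfold lift; infer_instance

theorem isAdmissibleLift {σ : VectorRadonMeasure Ω} {u : Plane → ℝ} (h1 : σ.DivFree)
    (h2 : σ.HasMarginal u) : IsAdmissibleLift Ω u σ.lift := by
  constructor
  · intro ψ hψ
    have hc : Continuous fun z : PosVec => testDiff ψ z.1 z.2 :=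
      (hψ.continuous_testDiff.comp continuous_fst).clm_apply continuous_snd
    rw [lift, integral_map σ.measurable_graph.aemeasurable hc.aestronglyMeasurable]
    exact σ.divFree_iff.1 h1 ψ hψ
  · intro φ hφ
    have hc : Continuous fun z : PosVec => fieldForm φ z.1 z.2 :=
      (hφ.continuous_fieldForm.comp continuous_fst).clm_apply continuous_snd
    rw [lift, integral_map σ.measurable_graph.aemeasurable hc.aestronglyMeasurable, ← h2 φ hφ]
    simp only [fieldForm_apply]
    rfl

theorem lintegral_lift (hf_convex : ConvexOn ℝ≥0 (univ : Set ℝ) f)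
    (hf_lsc : LowerSemicontinuous f) (hf_zero : f 0 ≠ ⊤) (σ : VectorRadonMeasure Ω) :
    ∫⁻ z, lineIntegrand f z.1.2 z.2.1 z.2.2 ∂σ.lift = σ.energy f := by
  rw [lift, lintegral_map _ σ.measurable_graph]
  · rfl
  · exact (measurable_lineIntegrand hf_convex hf_lsc hf_zero).comp
      (f := fun z : PosVec => (z.1.2, z.2)) (by fun_prop)

theorem lift_compl (σ : VectorRadonMeasure Ω) :
    σ.lift ((closure Ω ×ˢ univ) ×ˢ Metric.closedBall 0 1)ᶜ = 0 := by
  have hK : MeasurableSet ((closure Ω ×ˢ (univ : Set S1)) ×ˢ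
      Metric.closedBall (0 : Plane × ℝ) 1) :=
    (isClosed_closure.measurableSet.prod MeasurableSet.univ).prod
      Metric.isClosed_closedBall.measurableSet
  rw [lift, Measure.map_apply σ.measurable_graph hK.compl]
  refine mem_ae_iff.1 ?_
  filter_upwards [σ.ae_mem, σ.norm_dir_le] with q hq hd
  exact ⟨⟨subset_closure hq, trivial⟩, by simpa using hd⟩

/-- Coercivity: an energy bound is a mass bound, as weak compactness requires. -/
theorem mul_mass_le_energy {γ : ℝ} (hγ : 0 < γ)
    (hf : ∀ t : ℝ, ENNReal.ofReal (γ * Real.sqrt (1 + t ^ 2)) ≤ f t)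
    (σ : VectorRadonMeasure Ω) : ENNReal.ofReal γ * σ.lift univ ≤ σ.energy f := by
  rw [lift, Measure.map_apply σ.measurable_graph MeasurableSet.univ, preimage_univ,
    ← lintegral_const]
  refine lintegral_mono_ae ?_
  filter_upwards [σ.norm_dir] with q hq using le_lineIntegrand hγ hf _ _ _ hq

end VectorRadonMeasure

/-- Weak convergence of measures carried by a common compact set can be tested on continuous
functions which need not be bounded. -/
theorem tendsto_integral_of_isCompact {X ι : Type*} [TopologicalSpace X] [MeasurableSpace X]
    [OpensMeasurableSpace X] {K : Set X} (hK : IsCompact K) {l : Filter ι}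
    {ν : ι → FiniteMeasure X} {μ : FiniteMeasure X} (h : Tendsto ν l (𝓝 μ))
    (hν : ∀ᶠ i in l, (ν i : Measure X) Kᶜ = 0) (hμ : (μ : Measure X) Kᶜ = 0)
    {g : X → ℝ} (hg : Continuous g) :
    Tendsto (fun i => ∫ x, g x ∂(ν i : Measure X)) l (𝓝 (∫ x, g x ∂(μ : Measure X))) := by
  obtain ⟨C, hC⟩ := hK.exists_bound_of_continuousOn hg.continuousOn
  -- Clamping `g` at its bound on `K` makes it bounded without changing it on `K`, where all the
  -- measures live.
  have hgc : Continuous fun x => max (-|C|) (min |C| (g x)) := by fun_prop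
  let g' : BoundedContinuousFunction X ℝ :=
    BoundedContinuousFunction.ofNormedAddCommGroup _ hgc |C| fun x => by
      rw [Real.norm_eq_abs, abs_le]
      exact ⟨le_max_left _ _, max_le (by linarith [abs_nonneg C]) (min_le_left _ _)⟩
  have hgg : ∀ x ∈ K, g' x = g x := by
    intro x hx
    have h1 := (hC x hx).trans (le_abs_self C)
    rw [Real.norm_eq_abs, abs_le] at h1
    change max (-|C|) (min |C| (g x)) = g x
    rw [min_eq_right h1.2, max_eq_right h1.1]
  have key : ∀ ρ : Measure X, ρ Kᶜ = 0 → ∫ x, g' x ∂ρ = ∫ x, g x ∂ρ := by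
    intro ρ hρ
    refine integral_congr_ae ?_
    have : ∀ᵐ x ∂ρ, x ∈ K := mem_ae_iff.2 hρ
    filter_upwards [this] with x hx using hgg x hx
  have h2 := FiniteMeasure.tendsto_iff_forall_integral_tendsto.1 h g'
  rw [key _ hμ] at h2
  refine h2.congr' ?_
  filter_upwards [hν] with i hi using key _ hi

theorem tendsto_setIntegral_mul_of_eLpNorm {w : ℕ → Plane → ℝ} {u : Plane → ℝ}
    (hw : ∀ n, IntegrableOn (w n) Ω) (hu : IntegrableOn u Ω)
    (hlim : Tendsto (fun n => eLpNorm (fun x => w n x - u x) 1 (volume.restrict Ω)) atTop (𝓝 0))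
    {D : Plane → ℝ} (hD : Continuous D) (hDc : HasCompactSupport D) :
    Tendsto (fun n => ∫ x in Ω, w n x * D x) atTop (𝓝 (∫ x in Ω, u x * D x)) := by
  obtain ⟨C, hC⟩ := hD.bounded_above_of_compact_support hDc
  have hint : ∀ v : Plane → ℝ, IntegrableOn v Ω → Integrable (fun x => v x * D x)
      (volume.restrict Ω) := fun v hv =>
    Integrable.mul_bdd (c := C) hv hD.aestronglyMeasurable (ae_of_all _ hC)
  refine tendsto_integral_of_L1 _ (hint u hu).1 (Eventually.of_forall fun n => hint _ (hw n)) ?_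
  have h1 : Tendsto (fun n => ENNReal.ofReal C *
      eLpNorm (fun x => w n x - u x) 1 (volume.restrict Ω)) atTop (𝓝 0) := by
    simpa using ENNReal.Tendsto.const_mul hlim (Or.inr ENNReal.ofReal_ne_top)
  refine tendsto_of_tendsto_of_tendsto_of_le_of_le tendsto_const_nhds h1 (fun _ => zero_le)
    fun n => ?_
  change _ ≤ ENNReal.ofReal C * _
  rw [eLpNorm_one_eq_lintegral_enorm, ← lintegral_const_mul' _ _ ENNReal.ofReal_ne_top]
  refine lintegral_mono fun x => ?_
  rw [← sub_mul, enorm_mul, mul_comm]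
  refine mul_le_mul_left ?_ _
  rw [← ofReal_norm]
  exact ENNReal.ofReal_le_ofReal (hC x)

/-- Finite partial suprema are continuous, so their integrals pass to the limit and stay below `a`;
monotone convergence then recovers the full integrand. -/
theorem lintegral_lineIntegrand_le_of_tendsto (hf_convex : ConvexOn ℝ≥0 (univ : Set ℝ) f)
    (hf_lsc : LowerSemicontinuous f) (hf_zero : f 0 ≠ ⊤)
    {K : Set PosVec} (hK : IsCompact K) {ι : Type*} {l : Filter ι} [l.NeBot]
    {ν : ι → FiniteMeasure PosVec}
    {μ : FiniteMeasure PosVec} (h : Tendsto ν l (𝓝 μ))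
    (hν : ∀ᶠ i in l, (ν i : Measure PosVec) Kᶜ = 0) (hμ : (μ : Measure PosVec) Kᶜ = 0)
    {a : ℝ≥0∞}
    (ha : ∀ᶠ i in l, ∫⁻ z, lineIntegrand f z.1.2 z.2.1 z.2.2 ∂(ν i : Measure PosVec) ≤ a) :
    ∫⁻ z, lineIntegrand f z.1.2 z.2.1 z.2.2 ∂(μ : Measure PosVec) ≤ a := by
  obtain ⟨k, hk⟩ := exists_seq_lineIntegrand_eq_iSup hf_convex hf_lsc hf_zero
  let g : ℕ → PosVec → ℝ := fun n z => max (minorantForm (k n) z.1.2 z.2) 0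
  have hgc : ∀ n, Continuous (g n) := fun n =>
    (continuous_minorantForm.comp (f := fun z : PosVec =>
      (k n, z.1.2, z.2)) (by fun_prop)).max continuous_const
  let G : ℕ → PosVec → ℝ := fun N z => partialSups (fun n => g n z) N
  have hGc : ∀ N, Continuous (G N) := fun N => by
    induction N with
    | zero => simpa [G] using hgc 0
    | succ N ih =>
      have : G (N + 1) = fun z => max (G N z) (g (N + 1) z) := by
        ext z; simp [G, partialSups_add_one]
      rw [this]
      exact ih.max (hgc _)
  have hG0 : ∀ N z, 0 ≤ G N z := fun N z =>
    (le_max_right _ _).trans (le_partialSups_of_le (fun n => g n z) (Nat.zero_le N))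
  have hGle : ∀ N z, ENNReal.ofReal (G N z) ≤ lineIntegrand f z.1.2 z.2.1 z.2.2 := by
    intro N z
    by_cases ht : lineIntegrand f z.1.2 z.2.1 z.2.2 = ⊤
    · simp [ht]
    rw [ENNReal.ofReal_le_iff_le_toReal ht]
    refine partialSups_le _ _ _ fun n _ => max_le ?_ ENNReal.toReal_nonneg
    rw [← ENNReal.ofReal_le_iff_le_toReal ht, hk]
    exact le_iSup (fun n => ENNReal.ofReal (minorantForm (k n) z.1.2 z.2)) n
  have hGsup : ∀ z : PosVec,
      lineIntegrand f z.1.2 z.2.1 z.2.2 = ⨆ N, ENNReal.ofReal (G N z) := by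
    intro z
    refine le_antisymm ?_ (iSup_le fun N => hGle N z)
    rw [hk]
    refine iSup_mono fun n => ENNReal.ofReal_le_ofReal ?_
    exact (le_max_left _ _).trans (le_partialSups (fun n => g n z) n)
  have hGm : Monotone fun N z => ENNReal.ofReal (G N z) := fun N M hNM z =>
    ENNReal.ofReal_le_ofReal ((partialSups (fun n => g n z)).monotone hNM)
  simp only [hGsup]
  rw [lintegral_iSup (fun N => (hGc N).measurable.ennreal_ofReal) hGm]
  refine iSup_le fun N => ?_
  have hint : ∀ ρ : Measure PosVec, IsFiniteMeasure ρ → ρ Kᶜ = 0 →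
      ∫⁻ z, ENNReal.ofReal (G N z) ∂ρ = ENNReal.ofReal (∫ z, G N z ∂ρ) := by
    intro ρ _ hρ
    refine (ofReal_integral_eq_lintegral_ofReal ?_ (ae_of_all _ (hG0 N))).symm
    obtain ⟨C, hC⟩ := hK.exists_bound_of_continuousOn (hGc N).continuousOn
    refine Integrable.of_bound (hGc N).aestronglyMeasurable C ?_
    have : ∀ᵐ x ∂ρ, x ∈ K := mem_ae_iff.2 hρ
    filter_upwards [this] with x hx using hC x hx
  rw [hint _ inferInstance hμ]
  refine le_of_tendsto
    (ENNReal.tendsto_ofReal (tendsto_integral_of_isCompact hK h hν hμ (hGc N))) ?_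
  filter_upwards [hν, ha] with i hi hai
  rw [← hint _ inferInstance hi]
  exact (lintegral_mono (hGle N)).trans hai

/-- The functional is lower semicontinuous with respect to convergence in `L¹(Ω)`. -/
theorem totalRTVariation_le_liminf (hf_convex : ConvexOn ℝ≥0 (univ : Set ℝ) f)
    (hf_lsc : LowerSemicontinuous f)
    (hf_below : ∃ γ : ℝ, 0 < γ ∧ ∀ t : ℝ, ENNReal.ofReal (γ * Real.sqrt (1 + t ^ 2)) ≤ f t)
    (hf_zero : f 0 ≠ ⊤) (hΩ : MeasurableSet Ω) (hΩ_bdd : Bornology.IsBounded Ω)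
    {w : ℕ → Plane → ℝ} {u : Plane → ℝ}
    (hw : ∀ n, IntegrableOn (w n) Ω) (hu : IntegrableOn u Ω)
    (hlim : Tendsto (fun n => eLpNorm (fun x => w n x - u x) 1 (volume.restrict Ω))
      atTop (𝓝 0)) :
    totalRTVariation f Ω u ≤ liminf (fun n => totalRTVariation f Ω (w n)) atTop := by
  obtain ⟨γ, hγ, hfγ⟩ := hf_below
  refine le_of_forall_gt fun a ha => ?_
  obtain ⟨a', ha', haa'⟩ := exists_between ha
  refine lt_of_le_of_lt ?_ haa'
  have hat : a' ≠ ⊤ := (haa'.trans_le le_top).ne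
  have hfreq : ∃ᶠ n in atTop, totalRTVariation f Ω (w n) < a' :=
    frequently_lt_of_liminf_lt (by isBoundedDefault) ha'
  set s : Set ℕ := {n | totalRTVariation f Ω (w n) < a'} with hs
  have hne : (atTop ⊓ 𝓟 s).NeBot := frequently_mem_iff_neBot.1 hfreq
  -- An ultrafilter finer than `atTop` and concentrated on the indices in `s` plays the role of a
  -- convergent subsequence.
  let l : Ultrafilter ℕ := Ultrafilter.of (atTop ⊓ 𝓟 s)
  have hl : (l : Filter ℕ) ≤ atTop ⊓ 𝓟 s := Ultrafilter.of_le _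
  have hls : ∀ᶠ n in (l : Filter ℕ), n ∈ s := (hl.trans inf_le_right) (mem_principal_self s)
  set K : Set PosVec :=
    (closure Ω ×ˢ univ) ×ˢ Metric.closedBall 0 1 with hKdef
  have hK : IsCompact K :=
    (hΩ_bdd.isCompact_closure.prod isCompact_univ).prod (isCompact_closedBall _ _)
  have hex : ∀ n, ∃ ν : FiniteMeasure PosVec, n ∈ s →
      IsAdmissibleLift Ω (w n) (ν : Measure PosVec) ∧ (ν : Measure PosVec) Kᶜ = 0 ∧
      ENNReal.ofReal γ * (ν : Measure PosVec) univ ≤ a' ∧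
      ∫⁻ z, lineIntegrand f z.1.2 z.2.1 z.2.2 ∂(ν : Measure PosVec) ≤ a' := by
    intro n
    by_cases hn : n ∈ s
    · have h1 : totalRTVariation f Ω (w n) < a' := hn
      simp only [totalRTVariation, iInf_lt_iff] at h1
      obtain ⟨σ, hd, hm, hE⟩ := h1
      refine ⟨⟨σ.lift, inferInstance⟩, fun _ => ⟨σ.isAdmissibleLift hd hm, σ.lift_compl,
        (σ.mul_mass_le_energy hγ hfγ).trans hE.le, ?_⟩⟩
      exact (σ.lintegral_lift hf_convex hf_lsc hf_zero).le.trans hE.le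
    · exact ⟨0, fun h => absurd h hn⟩
  choose ν hν using hex
  -- The mass bound given by coercivity when the energy is at most `a'`.
  set C : ℝ≥0 := (a' / ENNReal.ofReal γ).toNNReal with hCdef
  have hγ0 : ENNReal.ofReal γ ≠ 0 := by simpa using hγ
  have hcomp := isCompact_setOfPred_finiteMeasure_le_of_isCompact C hK
  have hmem : ∀ᶠ n in (l : Filter ℕ), ν n ∈ {μ : FiniteMeasure PosVec | μ.mass ≤ C ∧ μ Kᶜ = 0} := by
    filter_upwards [hls] with n hn
    obtain ⟨-, h2, h3, -⟩ := hν n hn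
    refine ⟨?_, (FiniteMeasure.null_iff_toMeasure_null _ _).2 h2⟩
    rw [← ENNReal.coe_le_coe, hCdef, ENNReal.coe_toNNReal (ENNReal.div_ne_top hat hγ0),
      FiniteMeasure.ennreal_mass, ENNReal.le_div_iff_mul_le (Or.inl hγ0)
      (Or.inl ENNReal.ofReal_ne_top), mul_comm]
    exact h3
  obtain ⟨μ, hμmem, hμlim⟩ := hcomp.ultrafilter_le_nhds' (l.map ν) hmem
  have hμlim : Tendsto ν l (𝓝 μ) := hμlim
  have hμK : (μ : Measure PosVec) Kᶜ = 0 := (FiniteMeasure.null_iff_toMeasure_null _ _).1 hμmem.2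
  have hνK : ∀ᶠ n in (l : Filter ℕ), (ν n : Measure PosVec) Kᶜ = 0 := by
    filter_upwards [hls] with n hn using (hν n hn).2.1
  have hadm : IsAdmissibleLift Ω u (μ : Measure PosVec) := by
    constructor
    · intro ψ hψ
      have hc : Continuous fun z : PosVec => testDiff ψ z.1 z.2 :=
        (hψ.continuous_testDiff.comp continuous_fst).clm_apply continuous_snd
      refine tendsto_nhds_unique (tendsto_integral_of_isCompact hK hμlim hνK hμK hc)
        (tendsto_const_nhds.congr' ?_)
      filter_upwards [hls] with n hn using ((hν n hn).1.1 ψ hψ).symm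
    · intro φ hφ
      have hc : Continuous fun z : PosVec => fieldForm φ z.1 z.2 :=
        (hφ.continuous_fieldForm.comp continuous_fst).clm_apply continuous_snd
      have h1 := (tendsto_setIntegral_mul_of_eLpNorm hw hu hlim hφ.continuous_divergence
        hφ.hasCompactSupport_divergence).neg.mono_left (hl.trans inf_le_left)
      refine tendsto_nhds_unique (tendsto_integral_of_isCompact hK hμlim hνK hμK hc)
        (h1.congr' ?_)
      filter_upwards [hls] with n hn using ((hν n hn).1.2 φ hφ).symm
  have hint : Integrable (fun z : PosVec => z.2) (μ : Measure PosVec) := by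
    refine Integrable.of_bound continuous_snd.aestronglyMeasurable 1 ?_
    have : ∀ᵐ x ∂(μ : Measure PosVec), x ∈ K := mem_ae_iff.2 hμK
    filter_upwards [this] with x hx using by simpa using hx.2
  -- The weak limit may charge the boundary of `Ω`, and its vectors may be spread inside the unit
  -- ball; the barycenter takes care of both.
  refine (hadm.totalRTVariation_le hf_convex hf_lsc hf_zero hΩ hint).trans ?_
  refine lintegral_lineIntegrand_le_of_tendsto hf_convex hf_lsc hf_zero hK hμlim hνK hμK ?_
  filter_upwards [hls] with n hn using (hν n hn).2.2.2

end RotoTranslation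

/-! ### Averaged dilates and their energy -/

namespace RotoTranslation
variable {f : ℝ → ℝ≥0∞} {Ω : Set Plane}

theorem dilation_inv_dilation {t : ℝ} (ht : t ≠ 0) (y x : Plane) :
    dilation t y (dilation t⁻¹ y x) = x := by
  unfold dilation
  rw [smul_sub, smul_inv_smul₀ ht, smul_smul, sub_sub, ← add_smul]
  have : t * (t⁻¹ - 1) + (t - 1) = 0 := by field_simp; ring
  rw [this, zero_smul, sub_zero]

theorem integral_comp_dilation (t : ℝ) (y : Plane) (g : Plane → ℝ) :
    ∫ x, g (dilation t y x) = |(t ^ 2)⁻¹| * ∫ x, g x := by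
  unfold dilation
  rw [Measure.integral_comp_smul volume (fun x => g (x - (t - 1) • y)) t,
    integral_sub_right_eq_self]
  simp

theorem integrable_comp_dilation {t : ℝ} (ht : t ≠ 0) (y : Plane) {g : Plane → ℝ}
    (hg : Integrable g) : Integrable fun x => g (dilation t y x) :=
  (hg.comp_sub_right ((t - 1) • y)).comp_smul ht

theorem lintegral_enorm_comp_dilation {t : ℝ} (ht : t ≠ 0) (y : Plane) {g : Plane → ℝ}
    (hg : Integrable g) :
    ∫⁻ x, ‖g (dilation t y x)‖ₑ = ENNReal.ofReal |(t ^ 2)⁻¹| * ∫⁻ x, ‖g x‖ₑ := by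
  rw [← ofReal_integral_norm_eq_lintegral_enorm (integrable_comp_dilation ht y hg),
    ← ofReal_integral_norm_eq_lintegral_enorm hg,
    integral_comp_dilation t y (fun x => ‖g x‖), ENNReal.ofReal_mul (abs_nonneg _)]

/-- The average of the dilates of `u` of ratio `t`, with centers distributed according to `P`. -/
noncomputable def dilationAverage (P : Measure Plane) (t : ℝ) (u : Plane → ℝ) (x : Plane) : ℝ :=
  ∫ y, u (dilation t⁻¹ y x) ∂P

section Average

variable {P : Measure Plane} [IsProbabilityMeasure P] {u : Plane → ℝ}

theorem integrable_prod_comp_dilation (hum : Measurable u) (hu : Integrable u) {t : ℝ}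
    (ht : t ≠ 0) :
    Integrable (fun z : Plane × Plane => u (dilation t z.1 z.2)) (P.prod volume) := by
  have hm : Measurable fun z : Plane × Plane => u (dilation t z.1 z.2) :=
    hum.comp (continuous_dilation t).measurable
  rw [integrable_prod_iff hm.aestronglyMeasurable]
  refine ⟨ae_of_all _ fun y => integrable_comp_dilation ht y hu, ?_⟩
  simp only [integral_comp_dilation t _ (fun x => ‖u x‖)]
  exact integrable_const _

theorem integrable_dilationAverage (hum : Measurable u) (hu : Integrable u) {t : ℝ}
    (ht : t ≠ 0) : Integrable (dilationAverage P t u) :=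
  (integrable_prod_comp_dilation hum hu (inv_ne_zero ht)).integral_prod_right

/-- Change of variables with planar Jacobian `t ^ 2` for each center, then Fubini in the center. -/
theorem integral_integral_mul_comp_dilation (hum : Measurable u) (hu : Integrable u) {t : ℝ}
    (ht : t ≠ 0) {D : Plane → ℝ} (hD : Continuous D) (hDc : HasCompactSupport D) :
    t ^ 2 * ∫ y, (∫ x, u x * D (dilation t y x)) ∂P = ∫ x, dilationAverage P t u x * D x := by
  obtain ⟨C, hC⟩ := hD.bounded_above_of_compact_support hDc
  have h1 : ∀ y, t ^ 2 * ∫ x, u x * D (dilation t y x) = ∫ x, u (dilation t⁻¹ y x) * D x := by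
    intro y
    have h2 := integral_comp_dilation t⁻¹ y (fun x => u x * D (dilation t y x))
    simp only [dilation_inv_dilation ht] at h2
    rw [h2]
    simp
  have h3 : Integrable (fun z : Plane × Plane => u (dilation t⁻¹ z.1 z.2) * D z.2)
      (P.prod volume) :=
    (integrable_prod_comp_dilation hum hu (inv_ne_zero ht)).mul_bdd (c := C)
      (hD.comp continuous_snd).aestronglyMeasurable (ae_of_all _ fun z => hC z.2)
  rw [← integral_const_mul]
  simp only [h1]
  rw [integral_integral_swap h3]
  exact integral_congr_ae (ae_of_all _ fun x => integral_mul_const _ _)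

/-- The measure on position-vector pairs attached to the average of the dilates of a vector
measure. -/
noncomputable def VectorRadonMeasure.dilationLift (σ : VectorRadonMeasure Ω) (P : Measure Plane)
    (t : ℝ) : Measure PosVec :=
  (σ.tv.prod P).map fun z => ((dilation t z.2 z.1.1, z.1.2), (t • σ.dirX z.1, σ.dirθ z.1))

namespace VectorRadonMeasure

theorem measurable_dilationLift (σ : VectorRadonMeasure Ω) (t : ℝ) :
    Measurable fun z : (Plane × S1) × Plane =>
      (((dilation t z.2 z.1.1, z.1.2), (t • σ.dirX z.1, σ.dirθ z.1)) : PosVec) := by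
  have h1 : Measurable fun z : (Plane × S1) × Plane => dilation t z.2 z.1.1 :=
    ((continuous_dilation t).comp (f := fun z : (Plane × S1) × Plane => (z.2, z.1.1))
      (by fun_prop)).measurable
  have h2 := σ.measurable_dirX
  have h3 := σ.measurable_dirθ
  fun_prop

instance (σ : VectorRadonMeasure Ω) (t : ℝ) : IsFiniteMeasure (σ.dilationLift P t) := by
  unfold dilationLift; infer_instance

omit [IsProbabilityMeasure P] in
theorem ae_norm_dilate_le (σ : VectorRadonMeasure Ω) {t : ℝ} (ht : 1 ≤ t) :
    ∀ᵐ z ∂(σ.tv.prod P), ‖((t • σ.dirX z.1, σ.dirθ z.1) : Plane × ℝ)‖ ≤ t := by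
  have h := Measure.quasiMeasurePreserving_fst (μ := σ.tv) (ν := P)
  filter_upwards [h.ae σ.norm_dir_le, h.ae σ.norm_dirX_le] with z hz hx
  refine max_le ?_ ?_
  · simp only [norm_smul, Real.norm_of_nonneg (zero_le_one.trans ht)]
    exact mul_le_of_le_one_right (zero_le_one.trans ht) hx
  · exact (norm_snd_le (σ.dir z.1)).trans (hz.trans ht)

theorem integrable_dilationLift (σ : VectorRadonMeasure Ω) {t : ℝ} (ht : 1 ≤ t) :
    Integrable (fun z : PosVec => z.2) (σ.dilationLift P t) := by
  rw [dilationLift, integrable_map_measure continuous_snd.aestronglyMeasurable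
    (σ.measurable_dilationLift t).aemeasurable]
  exact Integrable.of_bound
    (measurable_snd.comp (σ.measurable_dilationLift t)).aestronglyMeasurable t
    (σ.ae_norm_dilate_le ht)

/-- Integration of a continuous bounded field of linear forms against the averaged dilates. -/
theorem integral_dilationLift (σ : VectorRadonMeasure Ω) {t : ℝ} (ht : 1 ≤ t)
    {G : Plane × S1 → (Plane × ℝ →L[ℝ] ℝ)} (hG : Continuous G) (hGb : ∃ C, ∀ q, ‖G q‖ ≤ C) :
    ∫ z, G z.1 z.2 ∂(σ.dilationLift P t)
      = ∫ y, ∫ q, G (dilation t y q.1, q.2) (t • σ.dirX q, σ.dirθ q) ∂σ.tv ∂P := by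
  obtain ⟨C, hC⟩ := hGb
  have hc : Continuous fun z : PosVec => G z.1 z.2 :=
    (hG.comp continuous_fst).clm_apply continuous_snd
  rw [dilationLift, integral_map (σ.measurable_dilationLift t).aemeasurable
    hc.aestronglyMeasurable, integral_prod_symm]
  refine Integrable.of_bound
    (hc.measurable.comp (σ.measurable_dilationLift t)).aestronglyMeasurable (C * t) ?_
  filter_upwards [σ.ae_norm_dilate_le (P := P) ht] with z hz
  exact ((G _).le_of_opNorm_le (hC _) _).trans
    (mul_le_mul_of_nonneg_left hz ((norm_nonneg _).trans (hC z.1)))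

/-- Almost every center lies in `Ω`, so each constraint can be tested with the pulled-back function.
In the marginal, one `t` comes from the rescaled vector and one from the divergence; together they
match the Jacobian `t ^ 2`. -/
theorem isAdmissibleLift_dilationLift (hΩ : Convex ℝ Ω) (hP : ∀ᵐ y ∂P, y ∈ Ω)
    {σ : VectorRadonMeasure Ω} (hum : Measurable u) (hu : Integrable u)
    (hu0 : ∀ x ∉ Ω, u x = 0) (h1 : σ.DivFree) (h2 : σ.HasMarginal u) {t : ℝ} (ht : 1 ≤ t) :
    IsAdmissibleLift Ω (dilationAverage P t u) (σ.dilationLift P t) := by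
  have ht0 : t ≠ 0 := by linarith
  constructor
  · intro ψ hψ
    rw [σ.integral_dilationLift ht hψ.continuous_testDiff hψ.exists_norm_testDiff_le]
    refine integral_eq_zero_of_ae ?_
    filter_upwards [hP] with y hy
    have h3 := σ.divFree_iff.1 h1 _ (hψ.comp_dilation hΩ ht hy)
    simp only [hψ.testDiff_comp_dilation] at h3
    exact h3
  · intro φ hφ
    have key : ∀ᵐ y ∂P, ∫ q, fieldForm φ (dilation t y q.1, q.2) (t • σ.dirX q, σ.dirθ q) ∂σ.tv
        = -t ^ 2 * ∫ x, u x * divergence φ (dilation t y x) := by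
      filter_upwards [hP] with y hy
      have h3 := h2 _ (hφ.comp_dilation hΩ ht hy)
      rw [setIntegral_eq_integral_of_forall_compl_eq_zero
          (fun x hx => by rw [hu0 x hx, zero_mul])] at h3
      simp only [hφ.divergence_comp_dilation, mul_left_comm _ t] at h3
      rw [integral_const_mul] at h3
      simp only [fieldForm_apply, inner_smul_right]
      rw [integral_const_mul, h3]
      ring
    rw [σ.integral_dilationLift ht hφ.continuous_fieldForm hφ.exists_norm_fieldForm_le,
      integral_congr_ae key, integral_const_mul, neg_mul,
      setIntegral_eq_integral_of_forall_compl_eq_zero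
        (fun x hx => by rw [hφ.divergence_eq_zero hx, mul_zero]),
      ← integral_integral_mul_comp_dilation hum hu ht0 hφ.continuous_divergence
        hφ.hasCompactSupport_divergence]

theorem lintegral_dilationLift_le (hf_convex : ConvexOn ℝ≥0 (univ : Set ℝ) f)
    (hf_lsc : LowerSemicontinuous f) (hf_zero : f 0 ≠ ⊤) (σ : VectorRadonMeasure Ω) {t : ℝ}
    (ht : 1 ≤ t) :
    ∫⁻ z, lineIntegrand f z.1.2 z.2.1 z.2.2 ∂(σ.dilationLift P t)
      ≤ σ.energy f + ENNReal.ofReal (t - 1) * (f 0 * σ.tv univ) := by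
  have hm : Measurable fun z : PosVec => lineIntegrand f z.1.2 z.2.1 z.2.2 :=
    (measurable_lineIntegrand hf_convex hf_lsc hf_zero).comp
      (f := fun z : PosVec => (z.1.2, z.2)) (by fun_prop)
  rw [dilationLift, lintegral_map hm (σ.measurable_dilationLift t)]
  have hmd : Measurable fun q => lineIntegrand f q.2 (t • σ.dirX q) (σ.dirθ q) := by
    have h2 := σ.measurable_dirX
    have h3 := σ.measurable_dirθ
    exact (measurable_lineIntegrand hf_convex hf_lsc hf_zero).comp
      (f := fun q : Plane × S1 => (q.2, (t • σ.dirX q, σ.dirθ q))) (by fun_prop)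
  change ∫⁻ z, lineIntegrand f z.1.2 (t • σ.dirX z.1) (σ.dirθ z.1) ∂(σ.tv.prod P) ≤ _
  have hmz : Measurable fun z : (Plane × S1) × Plane =>
      lineIntegrand f z.1.2 (t • σ.dirX z.1) (σ.dirθ z.1) := hmd.comp measurable_fst
  rw [lintegral_prod _ hmz.aemeasurable]
  simp only [lintegral_const, measure_univ, mul_one]
  calc _ ≤ ∫⁻ q, (lineIntegrand f q.2 (σ.dirX q) (σ.dirθ q)
            + ENNReal.ofReal (t - 1) * f 0) ∂σ.tv := by
        refine lintegral_mono_ae ?_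
        filter_upwards [σ.norm_dirX_le] with q hq
        refine (lineIntegrand_smul_le hf_convex hf_lsc hf_zero _ _ _ ht).trans ?_
        gcongr
        exact mul_le_of_le_one_right (by linarith) hq
    _ = _ := by
        rw [lintegral_add_right _ measurable_const, lintegral_const, mul_assoc]
        rfl

end VectorRadonMeasure

theorem totalRTVariation_dilationAverage_le (hf_convex : ConvexOn ℝ≥0 (univ : Set ℝ) f)
    (hf_lsc : LowerSemicontinuous f) (hf_zero : f 0 ≠ ⊤) (hΩm : MeasurableSet Ω)
    (hΩ : Convex ℝ Ω) (hP : ∀ᵐ y ∂P, y ∈ Ω) {σ : VectorRadonMeasure Ω} (hum : Measurable u)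
    (hu : Integrable u) (hu0 : ∀ x ∉ Ω, u x = 0) (h1 : σ.DivFree) (h2 : σ.HasMarginal u)
    {t : ℝ} (ht : 1 ≤ t) :
    totalRTVariation f Ω (dilationAverage P t u)
      ≤ σ.energy f + ENNReal.ofReal (t - 1) * (f 0 * σ.tv univ) :=
  ((VectorRadonMeasure.isAdmissibleLift_dilationLift hΩ hP hum hu hu0 h1 h2
    ht).totalRTVariation_le hf_convex hf_lsc hf_zero hΩm (σ.integrable_dilationLift ht)).trans
    (σ.lintegral_dilationLift_le hf_convex hf_lsc hf_zero ht)

/-- For a fixed competitor `σ` the error `(t - 1) f(0) |σ|` tends to zero; the infimum over `σ` is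
taken afterwards. -/
theorem limsup_totalRTVariation_dilationAverage_le (hf_convex : ConvexOn ℝ≥0 (univ : Set ℝ) f)
    (hf_lsc : LowerSemicontinuous f) (hf_zero : f 0 ≠ ⊤) (hΩm : MeasurableSet Ω)
    (hΩ : Convex ℝ Ω) (hP : ∀ᵐ y ∂P, y ∈ Ω) (hum : Measurable u)
    (hu : Integrable u) (hu0 : ∀ x ∉ Ω, u x = 0)
    {t : ℕ → ℝ} (ht : ∀ n, 1 ≤ t n) (htlim : Tendsto t atTop (𝓝 1)) :
    limsup (fun n => totalRTVariation f Ω (dilationAverage P (t n) u)) atTop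
      ≤ totalRTVariation f Ω u := by
  refine le_iInf fun σ => le_iInf fun h1 => le_iInf fun h2 => ?_
  have hlim : Tendsto (fun n => σ.energy f + ENNReal.ofReal (t n - 1) * (f 0 * σ.tv univ)) atTop
      (𝓝 (σ.energy f)) := by
    have h3 : Tendsto (fun n => ENNReal.ofReal (t n - 1)) atTop (𝓝 0) := by
      simpa using ENNReal.tendsto_ofReal (htlim.sub_const 1)
    have h4 := ENNReal.Tendsto.mul_const (b := f 0 * σ.tv univ) h3
      (Or.inr (ENNReal.mul_ne_top hf_zero (measure_ne_top _ _)))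
    simpa using h4.const_add (σ.energy f)
  rw [← hlim.limsup_eq]
  exact limsup_le_limsup (Eventually.of_forall fun n =>
    totalRTVariation_dilationAverage_le hf_convex hf_lsc hf_zero hΩm hΩ hP hum hu hu0 h1 h2 (ht n))

end Average

end RotoTranslation

/-! ### Smoothness and `L¹` convergence of the averages -/

namespace RotoTranslation

/-- The probability measure with smooth density a normed bump function. -/
noncomputable def bumpMeasure {c : Plane} (ρ : ContDiffBump c) : Measure Plane :=
  volume.withDensity fun y => ENNReal.ofReal (ρ.normed volume y)

variable {c : Plane} (ρ : ContDiffBump c)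

instance : IsProbabilityMeasure (bumpMeasure ρ) := by
  refine ⟨?_⟩
  rw [bumpMeasure, withDensity_apply _ MeasurableSet.univ, Measure.restrict_univ,
    ← ofReal_integral_eq_lintegral_ofReal ρ.integrable_normed
      (ae_of_all _ fun y => ρ.nonneg_normed y), ρ.integral_normed, ENNReal.ofReal_one]

theorem ae_bumpMeasure_mem : ∀ᵐ y ∂(bumpMeasure ρ), y ∈ Metric.ball c ρ.rOut := by
  rw [bumpMeasure, ae_withDensity_iff ρ.continuous_normed.measurable.ennreal_ofReal]
  refine ae_of_all _ fun y hy => ?_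
  rw [← ρ.support_normed_eq (μ := volume)]
  intro h
  exact hy (by rw [h, ENNReal.ofReal_zero])

theorem integral_bumpMeasure (g : Plane → ℝ) :
    ∫ y, g y ∂(bumpMeasure ρ) = ∫ y, ρ.normed volume y * g y := by
  rw [bumpMeasure, integral_withDensity_eq_integral_toReal_smul
    ρ.continuous_normed.measurable.ennreal_ofReal (ae_of_all _ fun y => ENNReal.ofReal_lt_top)]
  simp [ENNReal.toReal_ofReal (ρ.nonneg_normed _)]

/-- Averages of dilates of an integrable function with smoothly distributed centers are smooth. -/
theorem contDiff_dilationAverage {u : Plane → ℝ} (hu : Integrable u) {t : ℝ} (ht : 1 < t) :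
    ContDiff ℝ ∞ (dilationAverage (bumpMeasure ρ) t u) := by
  have hs1 : t⁻¹ < 1 := inv_lt_one_of_one_lt₀ ht
  set s := t⁻¹ with hs
  have hδ : 1 - s ≠ 0 := by linarith
  set δ := 1 - s with hδdef
  -- With `s = t⁻¹` and `δ = 1 - s`, the average at `x` is `∫ ρ(y) u(s x + δ y) dy`. Substituting `v
  -- = δ y` gives the convolution of `u` with this reflected, rescaled bump at `s • x`; `t > 1`
  -- ensures `δ ≠ 0`.
  let k : Plane → ℝ := fun v => ρ.normed volume (δ⁻¹ • (-v))
  have hk : ContDiff ℝ ∞ k := ρ.contDiff_normed.comp (by fun_prop)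
  have hkc : HasCompactSupport k := by
    have := (ρ.hasCompactSupport_normed (μ := volume)).comp_homeomorph
      ((Homeomorph.neg Plane).trans (Homeomorph.smulOfNeZero δ⁻¹ (inv_ne_zero hδ)))
    exact this
  have hconv : ContDiff ℝ ∞ (convolution u k (ContinuousLinearMap.mul ℝ ℝ) volume) :=
    hkc.contDiff_convolution_right _ hu.locallyIntegrable hk
  have heq : dilationAverage (bumpMeasure ρ) t u = fun x =>
      |(δ ^ 2)⁻¹| * convolution u k (ContinuousLinearMap.mul ℝ ℝ) volume (s • x) := by
    ext x
    rw [dilationAverage, integral_bumpMeasure, convolution_def]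
    have h1 := Measure.integral_comp_smul volume
      (fun v => ρ.normed volume (δ⁻¹ • v) * u (s • x + v)) δ
    have h2 := integral_add_left_eq_self (μ := volume)
      (fun v : Plane => u v * k (s • x - v)) (s • x)
    simp only [smul_smul, inv_mul_cancel₀ hδ, one_smul] at h1
    calc _ = ∫ y, ρ.normed volume y * u (s • x + δ • y) := by
          refine integral_congr_ae (ae_of_all _ fun y => ?_)
          have : dilation t⁻¹ y x = s • x + δ • y := by
            rw [dilation, ← hs, hδdef]; module
          simp only [this]
      _ = _ := by
          rw [h1, smul_eq_mul]
          congr 1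
          · simp
          · simp only [ContinuousLinearMap.mul_apply']
            rw [← h2]
            refine integral_congr_ae (ae_of_all _ fun y => ?_)
            simp only [k, sub_add_cancel_left, neg_neg]
            ring
  rw [heq]
  exact contDiff_const.mul (hconv.comp (by fun_prop))

theorem tendsto_lintegral_enorm_comp_dilation_sub_of_continuous {g : Plane → ℝ}
    (hg : Continuous g) (hgc : HasCompactSupport g) (y : Plane) {s : ℕ → ℝ}
    (hs : ∀ n, s n ∈ Icc (1 / 2 : ℝ) 1) (hslim : Tendsto s atTop (𝓝 1)) :
    Tendsto (fun n => ∫⁻ x, ‖g (dilation (s n) y x) - g x‖ₑ) atTop (𝓝 0) := by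
  obtain ⟨C, hC⟩ := hg.bounded_above_of_compact_support hgc
  obtain ⟨R, hR⟩ := hgc.isBounded.subset_closedBall (0 : Plane)
  have hR0 : ∀ x, R < ‖x‖ → g x = 0 := fun x hx =>
    image_eq_zero_of_notMem_tsupport fun h => by
      have := hR h
      rw [mem_closedBall_zero_iff] at this
      linarith
  have hlim : ∀ x, Tendsto (fun n => ‖g (dilation (s n) y x) - g x‖ₑ) atTop (𝓝 0) := by
    intro x
    have h1 : Continuous fun r : ℝ => ‖g (dilation r y x) - g x‖ₑ := by
      unfold dilation
      fun_prop
    have h2 := (h1.tendsto 1).comp hslim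
    have h3 : dilation 1 y x = x := by simp [dilation]
    simpa [h3, Function.comp_def] using h2
  have hz : (∫⁻ _ : Plane, (0 : ℝ≥0∞)) = 0 := lintegral_zero
  rw [← hz]
  -- If `‖x‖ > 2 (|R| + ‖y‖)`, then `s ≥ 1 / 2` gives `‖s x + (1 - s) y‖ ≥ (‖x‖ - ‖y‖) / 2 > R`, so
  -- both terms vanish outside a ball independent of `n`.
  refine tendsto_lintegral_of_dominated_convergence
    (indicator (Metric.closedBall 0 (2 * (|R| + ‖y‖))) fun _ => ENNReal.ofReal (2 * C))
    (fun n => ?_) (fun n => ae_of_all _ fun x => ?_) ?_ (ae_of_all _ hlim)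
  · refine (Continuous.enorm (Continuous.sub (hg.comp ?_) hg)).measurable
    unfold dilation
    fun_prop
  · by_cases hx : x ∈ Metric.closedBall (0 : Plane) (2 * (|R| + ‖y‖))
    · rw [indicator_of_mem hx]
      change ‖g (dilation (s n) y x) - g x‖ₑ ≤ _
      rw [← ofReal_norm]
      refine ENNReal.ofReal_le_ofReal ((norm_sub_le _ _).trans ?_)
      linarith [hC (dilation (s n) y x), hC x]
    · rw [mem_closedBall_zero_iff, not_le] at hx
      have h0 := norm_nonneg y
      have h1 : g x = 0 := hR0 x (by linarith [le_abs_self R, abs_nonneg R])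
      have h2 : g (dilation (s n) y x) = 0 := by
        refine hR0 _ ?_
        obtain ⟨h3, h4⟩ := hs n
        have h5 : ‖s n • x‖ - ‖(s n - 1) • y‖ ≤ ‖dilation (s n) y x‖ := norm_sub_norm_le _ _
        rw [norm_smul, norm_smul, Real.norm_of_nonneg (by linarith), Real.norm_eq_abs,
          abs_of_nonpos (by linarith)] at h5
        nlinarith [le_abs_self R, norm_nonneg x]
      simp [h1, h2]
  · rw [lintegral_indicator Metric.isClosed_closedBall.measurableSet, lintegral_const,
      Measure.restrict_apply_univ]
    exact ENNReal.mul_ne_top ENNReal.ofReal_ne_top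
      (isCompact_closedBall _ _).measure_lt_top.ne

theorem ofReal_abs_inv_sq_le {s : ℝ} (hs : 1 / 2 ≤ s) :
    ENNReal.ofReal |(s ^ 2)⁻¹| ≤ 4 := by
  have h1 : |(s ^ 2)⁻¹| ≤ 4 := by
    rw [abs_of_nonneg (by positivity)]
    refine inv_le_of_inv_le₀ (by norm_num) ?_
    nlinarith
  calc ENNReal.ofReal |(s ^ 2)⁻¹| ≤ ENNReal.ofReal 4 := ENNReal.ofReal_le_ofReal h1
    _ = 4 := by norm_num

theorem tendsto_lintegral_enorm_comp_dilation_sub {u : Plane → ℝ} (hu : Integrable u) (y : Plane)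
    {s : ℕ → ℝ} (hs : ∀ n, s n ∈ Icc (1 / 2 : ℝ) 1) (hslim : Tendsto s atTop (𝓝 1)) :
    Tendsto (fun n => ∫⁻ x, ‖u (dilation (s n) y x) - u x‖ₑ) atTop (𝓝 0) := by
  rw [ENNReal.tendsto_nhds_zero]
  intro ε hε
  -- Six shares: the dilated error `u - g` costs up to `4`, the Jacobian bound for `s ≥ 1 / 2`, and
  -- the other two terms cost one each.
  have hε6 : ε / 6 ≠ 0 := (ENNReal.div_pos hε.ne' (by norm_num)).ne'
  obtain ⟨g, hgc, hgε, hg, hgi⟩ := hu.exists_hasCompactSupport_lintegral_sub_le hε6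
  have h1 := ENNReal.tendsto_nhds_zero.1
    (tendsto_lintegral_enorm_comp_dilation_sub_of_continuous hg hgc y hs hslim) (ε / 6)
    (pos_iff_ne_zero.2 hε6)
  filter_upwards [h1] with n hn
  have hsn : s n ≠ 0 := by have := (hs n).1; linarith
  have hd : Integrable fun x => u x - g x := hu.sub hgi
  have h2 : ∫⁻ x, ‖u (dilation (s n) y x) - g (dilation (s n) y x)‖ₑ ≤ 4 * (ε / 6) := by
    rw [lintegral_enorm_comp_dilation hsn y hd]
    exact mul_le_mul' (ofReal_abs_inv_sq_le (hs n).1) hgε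
  have h3 : ∫⁻ x, ‖g x - u x‖ₑ ≤ ε / 6 := by
    simpa only [enorm_sub_rev (g _) (u _)] using hgε
  have hgu : AEMeasurable fun x => ‖g x - u x‖ₑ := (hgi.sub hu).1.enorm
  have hdd := integrable_comp_dilation hsn y hd
  calc _ ≤ ∫⁻ x, (‖u (dilation (s n) y x) - g (dilation (s n) y x)‖ₑ
          + ‖g (dilation (s n) y x) - g x‖ₑ + ‖g x - u x‖ₑ) := by
        refine lintegral_mono fun x => ?_
        have : u (dilation (s n) y x) - u x = (u (dilation (s n) y x) - g (dilation (s n) y x))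
          + (g (dilation (s n) y x) - g x) + (g x - u x) := by ring
        rw [this]
        exact (enorm_add_le _ _).trans (add_le_add_left (enorm_add_le _ _) _)
    _ ≤ 4 * (ε / 6) + ε / 6 + ε / 6 := by
        rw [lintegral_add_right' _ hgu,
          lintegral_add_left' hdd.1.enorm]
        exact add_le_add (add_le_add h2 hn) h3
    _ = 6 * (ε / 6) := by ring
    _ ≤ ε := ENNReal.mul_div_le

theorem tendsto_eLpNorm_dilationAverage_sub {P : Measure Plane} [IsProbabilityMeasure P]
    {u : Plane → ℝ} (hum : Measurable u) (hu : Integrable u) {t : ℕ → ℝ}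
    (ht : ∀ n, t n ∈ Icc (1 : ℝ) 2) (htlim : Tendsto t atTop (𝓝 1)) :
    Tendsto (fun n => eLpNorm (fun x => dilationAverage P (t n) u x - u x) 1 volume)
      atTop (𝓝 0) := by
  have ht0 : ∀ n, 0 < t n := fun n => by linarith [(ht n).1]
  have hs : ∀ n, (t n)⁻¹ ∈ Icc (1 / 2 : ℝ) 1 := fun n =>
    ⟨by rw [one_div]; exact inv_anti₀ (ht0 n) (ht n).2, inv_le_one_of_one_le₀ (ht n).1⟩
  have hslim : Tendsto (fun n => (t n)⁻¹) atTop (𝓝 1) := by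
    simpa using htlim.inv₀ one_ne_zero
  have hmeas : ∀ n, Measurable fun z : Plane × Plane => ‖u (dilation (t n)⁻¹ z.1 z.2) - u z.2‖ₑ :=
    fun n => ((hum.comp (continuous_dilation _).measurable).sub (hum.comp measurable_snd)).enorm
  have hfin : ∫⁻ x, ‖u x‖ₑ ≠ ⊤ := hu.2.ne
  -- For each center the `L¹` distance tends to zero, and it is at most `5` times the norm of `u`
  -- uniformly in the center; dominated convergence applies under `P`.
  have hlim : Tendsto (fun n => ∫⁻ y, (∫⁻ x, ‖u (dilation (t n)⁻¹ y x) - u x‖ₑ) ∂P) atTop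
      (𝓝 (∫⁻ _ : Plane, 0 ∂P)) := by
    refine tendsto_lintegral_of_dominated_convergence
      (fun _ => 4 * (∫⁻ x, ‖u x‖ₑ) + ∫⁻ x, ‖u x‖ₑ) (fun n => (hmeas n).lintegral_prod_right')
      (fun n => ae_of_all _ fun y => ?_) ?_
      (ae_of_all _ fun y => tendsto_lintegral_enorm_comp_dilation_sub hu y hs hslim)
    · have h1 := integrable_comp_dilation (inv_ne_zero (ht0 n).ne') y hu
      calc _ ≤ ∫⁻ x, (‖u (dilation (t n)⁻¹ y x)‖ₑ + ‖u x‖ₑ) :=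
            lintegral_mono fun x => enorm_sub_le
        _ ≤ _ := by
            rw [lintegral_add_left' h1.1.enorm,
              lintegral_enorm_comp_dilation (inv_ne_zero (ht0 n).ne') y hu]
            exact add_le_add_left (mul_le_mul_left (ofReal_abs_inv_sq_le (hs n).1) _) _
    · rw [lintegral_const, measure_univ, mul_one]
      exact ENNReal.add_ne_top.2 ⟨ENNReal.mul_ne_top (by norm_num) hfin, hfin⟩
  rw [lintegral_zero] at hlim
  refine tendsto_of_tendsto_of_tendsto_of_le_of_le tendsto_const_nhds hlim (fun _ => zero_le)
    fun n => ?_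
  change eLpNorm _ 1 volume ≤ ∫⁻ y, (∫⁻ x, ‖u (dilation (t n)⁻¹ y x) - u x‖ₑ) ∂P
  rw [lintegral_lintegral_swap (hmeas n).aemeasurable, eLpNorm_one_eq_lintegral_enorm]
  have hae := (integrable_prod_comp_dilation (P := P) hum hu
    (inv_ne_zero (ht0 n).ne')).prod_left_ae
  refine lintegral_mono_ae ?_
  filter_upwards [hae] with x hx
  have : dilationAverage P (t n) u x - u x = ∫ y, (u (dilation (t n)⁻¹ y x) - u x) ∂P := by
    rw [integral_sub hx (integrable_const _), integral_const]
    simp [dilationAverage]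
  rw [this]
  exact enorm_integral_le_lintegral_enorm _

/-! ### The recovery sequence and the conclusion -/

variable {f : ℝ → ℝ≥0∞} {Ω : Set Plane}

theorem totalRTVariation_congr_ae {u v : Plane → ℝ} (h : u =ᵐ[volume.restrict Ω] v) :
    totalRTVariation f Ω u = totalRTVariation f Ω v := by
  have : ∀ σ : VectorRadonMeasure Ω, σ.HasMarginal u ↔ σ.HasMarginal v := by
    intro σ
    refine forall₂_congr fun φ _ => ?_
    have : ∫ x in Ω, u x * divergence φ x = ∫ x in Ω, v x * divergence φ x := by
      refine integral_congr_ae ?_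
      filter_upwards [h] with x hx
      rw [hx]
    rw [this]
  simp only [totalRTVariation, this]

/-- Approximation in energy of a measurable integrable function vanishing outside `Ω`. -/
theorem exists_smooth_approximation (hf_convex : ConvexOn ℝ≥0 (univ : Set ℝ) f)
    (hf_lsc : LowerSemicontinuous f)
    (hf_below : ∃ γ : ℝ, 0 < γ ∧ ∀ t : ℝ, ENNReal.ofReal (γ * Real.sqrt (1 + t ^ 2)) ≤ f t)
    (hf_zero : f 0 ≠ ⊤) (hΩ_open : IsOpen Ω) (hΩ_bdd : Bornology.IsBounded Ω)
    (hΩ_convex : Convex ℝ Ω) (hΩ_ne : Ω.Nonempty) {u : Plane → ℝ} (hum : Measurable u)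
    (hu : Integrable u) (hu0 : ∀ x ∉ Ω, u x = 0) :
    ∃ w : ℕ → Plane → ℝ, (∀ n, ContDiff ℝ ∞ (w n)) ∧
      Tendsto (fun n => eLpNorm (fun x => w n x - u x) 1 (volume.restrict Ω)) atTop (𝓝 0) ∧
      Tendsto (fun n => totalRTVariation f Ω (w n)) atTop (𝓝 (totalRTVariation f Ω u)) := by
  obtain ⟨c, hc⟩ := hΩ_ne
  obtain ⟨r, hr, hball⟩ := Metric.isOpen_iff.1 hΩ_open c hc
  -- The outer radius keeps almost every center inside `Ω`, as admissibility of the dilates needs.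
  let ρ : ContDiffBump c := ⟨r / 2, r, by linarith, by linarith⟩
  have hP : ∀ᵐ y ∂(bumpMeasure ρ), y ∈ Ω := by
    filter_upwards [ae_bumpMeasure_mem ρ] with y hy using hball hy
  let t : ℕ → ℝ := fun n => 1 + 1 / ((n : ℝ) + 1)
  have ht1 : ∀ n, 1 < t n := fun n => by
    have : (0 : ℝ) < 1 / ((n : ℝ) + 1) := by positivity
    simp only [t]; linarith
  have ht2 : ∀ n, t n ∈ Icc (1 : ℝ) 2 := fun n => by
    refine ⟨(ht1 n).le, ?_⟩
    have : 1 / ((n : ℝ) + 1) ≤ 1 := by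
      rw [div_le_one (by positivity)]
      linarith [Nat.cast_nonneg (α := ℝ) n]
    simp only [t]; linarith
  have htlim : Tendsto t atTop (𝓝 1) := by
    simpa only [add_zero] using (tendsto_one_div_add_atTop_nhds_zero_nat (𝕜 := ℝ)).const_add 1
  have hL1 : Tendsto (fun n => eLpNorm
      (fun x => dilationAverage (bumpMeasure ρ) (t n) u x - u x) 1 (volume.restrict Ω))
      atTop (𝓝 0) :=
    tendsto_of_tendsto_of_tendsto_of_le_of_le tendsto_const_nhds
      (tendsto_eLpNorm_dilationAverage_sub hum hu ht2 htlim) (fun _ => zero_le)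
      fun n => eLpNorm_mono_measure _ Measure.restrict_le_self
  refine ⟨fun n => dilationAverage (bumpMeasure ρ) (t n) u,
    fun n => contDiff_dilationAverage ρ hu (ht1 n), hL1, ?_⟩
  refine tendsto_of_le_liminf_of_limsup_le ?_ ?_
  · exact totalRTVariation_le_liminf hf_convex hf_lsc hf_below hf_zero hΩ_open.measurableSet hΩ_bdd
      (fun n => (integrable_dilationAverage hum hu (by linarith [ht1 n])).integrableOn)
      hu.integrableOn hL1
  · exact limsup_totalRTVariation_dilationAverage_le hf_convex hf_lsc hf_zero
      hΩ_open.measurableSet hΩ_convex hP hum hu hu0 (fun n => (ht1 n).le) htlim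

end RotoTranslation

theorem mainTheorem2
    (f : ℝ → ℝ≥0∞) (hf_convex : ConvexOn ℝ≥0 (univ : Set ℝ) f) (hf_lsc : LowerSemicontinuous f)
    (hf_below : ∃ γ : ℝ, 0 < γ ∧ ∀ t : ℝ, ENNReal.ofReal (γ * Real.sqrt (1 + t ^ 2)) ≤ f t)
    (hf_zero : f 0 ≠ ⊤)
    (Ω : Set RotoTranslation.Plane) (hΩ_open : IsOpen Ω) (hΩ_bdd : Bornology.IsBounded Ω)
    (hΩ_convex : Convex ℝ Ω)
    (u : RotoTranslation.Plane → ℝ) (hu : IntegrableOn u Ω volume)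
    (hFu : RotoTranslation.totalRTVariation f Ω u < ⊤) :
    ∃ w : ℕ → RotoTranslation.Plane → ℝ,
      (∀ n, RotoTranslation.SmoothUpToBoundary Ω (w n)) ∧
      Tendsto (fun n => eLpNorm (fun x => w n x - u x) 1 (volume.restrict Ω)) atTop (𝓝 0) ∧
      Tendsto (fun n => RotoTranslation.totalRTVariation f Ω (w n)) atTop
        (𝓝 (RotoTranslation.totalRTVariation f Ω u)) := by
  -- The empty domain offers no center of dilation and is settled by constants.
  rcases Ω.eq_empty_or_nonempty with rfl | hΩ_ne
  · refine ⟨fun _ _ => 0, fun _ => ⟨fun _ => 0, contDiff_const, fun _ _ => rfl⟩, by simp, ?_⟩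
    refine tendsto_const_nhds.congr fun _ => ?_
    exact RotoTranslation.totalRTVariation_congr_ae (by simp [EventuallyEq])
  -- A Borel representative, cut off outside `Ω`, makes `(y, x) ↦ u (dilation t y x)` measurable and
  -- turns integrals over `Ω` into integrals over the plane; `F` depends only on the class of `u` on
  -- `Ω`.
  have hum : Measurable (hu.1.mk u) := hu.1.stronglyMeasurable_mk.measurable
  have hae : u =ᵐ[volume.restrict Ω] Ω.indicator (hu.1.mk u) :=
    hu.1.ae_eq_mk.trans (indicator_ae_eq_restrict hΩ_open.measurableSet).symm
  have hint : Integrable (Ω.indicator (hu.1.mk u)) :=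
    (integrable_indicator_iff hΩ_open.measurableSet).2 (Integrable.congr hu hu.1.ae_eq_mk)
  obtain ⟨w, hw, hL1, hF⟩ := RotoTranslation.exists_smooth_approximation hf_convex hf_lsc hf_below
    hf_zero hΩ_open hΩ_bdd hΩ_convex hΩ_ne (hum.indicator hΩ_open.measurableSet) hint
    fun x hx => indicator_of_notMem hx _
  refine ⟨w, fun n => ⟨w n, hw n, fun _ _ => rfl⟩, hL1.congr fun n => ?_, ?_⟩
  · refine eLpNorm_congr_ae ?_
    filter_upwards [hae] with x hx
    rw [hx]
  · rwa [RotoTranslation.totalRTVariation_congr_ae hae]
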